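/- Let $P$ be a convex polytope (a bounded one, the convex hull of finitely many points). A linear functional $f$ is called admissible for $P$ if it is not constant on any edge of $P$. Such an $f$ orients the graph of $P$: each edge is directed so that $f$ increases along it. A source is a vertex that no edge enters and a sink is a vertex that no edge leaves. For integers $0<d<n$, let $\Delta_{sm}(d,n)$ be the maximum, over all $d$-dimensional polytopes $P$ with exactly $n$ facets and all admissible functionals $f$ for $P$, of the length (number of edges) of a shortest directed path from the source of $P$ to the sink of $P$. Then $$\Delta_{sm}(5,10)\le 6.$$ That is, for every $5$-dimensional convex polytope with $10$ facets and every admissible linear functional, there is a directed path with at most $6$ edges from the source to the sink. -/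

import Mathlib

namespace MonotoneDiameter

section Basic

variable {E : Type*} [NormedAddCommGroup E] [NormedSpace ℝ E]

/-- A convex polytope: the convex hull of a nonempty finite set of points. -/
def IsPolytope (P : Set E) : Prop :=
  ∃ S : Set E, S.Finite ∧ S.Nonempty ∧ P = convexHull ℝ S

/-- The dimension of a nonempty set: the dimension of its affine span. -/
noncomputable def affDim (F : Set E) : ℕ :=
  Module.finrank ℝ (vectorSpan ℝ F)

/-- A nonempty face of `P`: the set of maximizers over `P` of some linear functional. -/
def IsFace (P F : Set E) : Prop :=
  F.Nonempty ∧ IsExposed ℝ P F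

/-- A facet of `P`: a face whose dimension is one less than that of `P`. -/
def IsFacet (P F : Set E) : Prop :=
  IsFace P F ∧ affDim F + 1 = affDim P

/-- `v` is a vertex of `P`: the set `{v}` is a face. -/
def IsVertex (P : Set E) (v : E) : Prop :=
  IsFace P {v}

/-- `u` and `v` are the two ends of an edge of `P`: the edges of a polytope are its
one-dimensional faces, that is, the non-degenerate segments that are faces. -/
def IsEdge (P : Set E) (u v : E) : Prop :=
  u ≠ v ∧ IsFace P (segment ℝ u v)

/-- `f` is admissible for `P`: it is not constant on any edge of `P`. -/
def IsAdmissible (P : Set E) (f : E →ₗ[ℝ] ℝ) : Prop :=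
  ∀ u v : E, IsEdge P u v → ¬ ∃ c : ℝ, ∀ x ∈ segment ℝ u v, f x = c

/-- There is an arc from `u` to `v` in the graph of `P` oriented by `f`: the edges are directed
so that `f` increases. -/
def Arc (P : Set E) (f : E →ₗ[ℝ] ℝ) (u v : E) : Prop :=
  IsEdge P u v ∧ f u < f v

/-- A source: a vertex that no arc enters. -/
def IsSource (P : Set E) (f : E →ₗ[ℝ] ℝ) (v : E) : Prop :=
  IsVertex P v ∧ ∀ u : E, ¬ Arc P f u v

/-- A sink: a vertex that no arc leaves. -/
def IsSink (P : Set E) (f : E →ₗ[ℝ] ℝ) (v : E) : Prop :=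
  IsVertex P v ∧ ∀ u : E, ¬ Arc P f v u

/-- There is a directed path with exactly `k` arcs from `u` to `v`. Its vertices are distinct,
because `f` increases along each arc. -/
def HasDirectedPath (P : Set E) (f : E →ₗ[ℝ] ℝ) (k : ℕ) (u v : E) : Prop :=
  ∃ p : Fin (k + 1) → E, p 0 = u ∧ p (Fin.last k) = v ∧
    ∀ i : Fin k, Arc P f (p i.castSucc) (p i.succ)

/-- The length of a shortest directed path from `u` to `v`; it is `⊤` if there is none. -/
noncomputable def directedDist (P : Set E) (f : E →ₗ[ℝ] ℝ) (u v : E) : ℕ∞ :=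
  sInf {l : ℕ∞ | ∃ k : ℕ, l = k ∧ HasDirectedPath P f k u v}

end Basic

/-- The strict monotone diameter `Δ_sm(d, n)`: the largest possible length of a shortest directed
path from the source to the sink of a `d`-dimensional polytope with exactly `n` facets, in the
orientation of its graph by an admissible functional. The supremum is taken in `ℕ∞`, so that an
upper bound by a number is a bound for all these polytopes and functionals. -/
noncomputable def deltaSM (d n : ℕ) : ℕ∞ :=
  sSup {l : ℕ∞ | ∃ (m : ℕ) (P : Set (EuclideanSpace ℝ (Fin m)))
    (f : EuclideanSpace ℝ (Fin m) →ₗ[ℝ] ℝ) (s t : EuclideanSpace ℝ (Fin m)),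
    IsPolytope P ∧ affDim P = d ∧ {F | IsFacet P F}.encard = n ∧ IsAdmissible P f ∧
      IsSource P f s ∧ IsSink P f t ∧ l = directedDist P f s t}

end MonotoneDiameter

/-!
Let `P` be a `5`-polytope with ten facets, `s` its source and `t` its sink.

*Facets met first.* The lowest vertex `x` on any of the facets through `t` is the source of such a
facet `F`, of which `t` is the sink, and a lower neighbour `v` of `x` lies on no facet through `t`
(`Presents.exists_first`). If `s` and `t` share no facet, then nearly all facets through `v` contain
`s`, since ten facets (nine in dimension four) leave little room besides at least `d` facets through
`s` and at least `d` through `t`. Hence `v` is `s` or a neighbour of `s` (`isEdge_of_common_tight`),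
and `x` is at distance at most two from `s`. In dimension four this bounds the distance from `s` to
`t` by `2 + 4`, where four is the bound for the `3`-polytope `F`, which has at most eight facets
(`exists_path_dim_four`). In dimension five the ten facets are divided between `s` and `t`, so `v`
must be `s` itself and `x` is a neighbour of `s`; the same argument inside `F` then leads in at
most two steps from `s` to the source of a `3`-dimensional face through `t` with at most eight
facets, and the bound is again `2 + 4` (`exists_path_dim_five`). If `s` and `t` share a facet, the
bound of the dimension below applies to it.

*Dimension three.* A `3`-polytope with at most eight facets has at most twelve vertices, because
every vertex besides source and sink is the source or the sink of a facet
(`Presents.card_vertices_le`). On the other hand, fewer than `d` vertices cannot cut the source of a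
`d`-polytope off from the sink: a suitable shadow path avoids them (`exists_arc_leaving`). So if
the distance from source to sink were more than four, there would be four layers of at least three
vertices between them, fourteen vertices in all (`le_card_vertices`).

*Polyhedral background.* Polytopes are described by irredundant systems of inequalities
(`Presents`), which exist by Fourier-Motzkin elimination. Edges are found by local improvement: a
vertex that does not maximize a linear functional has a neighbour that is better
(`IsVertex.exists_isEdge`). No simplicity of `P` is needed.
-/

namespace MonotoneDiameter

variable {E : Type*} [NormedAddCommGroup E] [NormedSpace ℝ E]

/-! ### Faces, vertices and edges of polytopes -/

theorem IsPolytope.isCompact {P : Set E} (hP : IsPolytope P) : IsCompact P := by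
  obtain ⟨S, hS, -, rfl⟩ := hP
  exact hS.isCompact_convexHull ℝ

theorem IsPolytope.convex {P : Set E} (hP : IsPolytope P) : Convex ℝ P := by
  obtain ⟨S, -, -, rfl⟩ := hP
  exact convex_convexHull ℝ S

theorem IsPolytope.nonempty {P : Set E} (hP : IsPolytope P) : P.Nonempty := by
  obtain ⟨S, -, hS, rfl⟩ := hP
  exact hS.convexHull

theorem IsPolytope.finite_extremePoints {P : Set E} (hP : IsPolytope P) :
    (P.extremePoints ℝ).Finite := by
  obtain ⟨S, hS, -, rfl⟩ := hP
  exact hS.subset extremePoints_convexHull_subset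

theorem convexHull_extremePoints_eq {P : Set E} (hc : IsCompact P) (hconv : Convex ℝ P)
    (hf : (P.extremePoints ℝ).Finite) : convexHull ℝ (P.extremePoints ℝ) = P := by
  have h := closure_convexHull_extremePoints hc hconv
  rwa [(hf.isClosed_convexHull ℝ).closure_eq] at h

theorem isPolytope_of_finite_extremePoints {P : Set E} (hc : IsCompact P) (hconv : Convex ℝ P)
    (hne : P.Nonempty) (hf : (P.extremePoints ℝ).Finite) : IsPolytope P :=
  ⟨_, hf, hc.extremePoints_nonempty hne, (convexHull_extremePoints_eq hc hconv hf).symm⟩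

theorem IsFace.isPolytope {P F : Set E} (hP : IsPolytope P) (hF : IsFace P F) : IsPolytope F :=
  isPolytope_of_finite_extremePoints (hF.2.isCompact hP.isCompact) (hF.2.convex hP.convex) hF.1
    (hP.finite_extremePoints.subset hF.2.isExtreme.extremePoints_subset_extremePoints)

theorem IsFace.subset {P F : Set E} (hF : IsFace P F) : F ⊆ P := hF.2.subset

theorem IsVertex.mem {P : Set E} {v : E} (hv : IsVertex P v) : v ∈ P := hv.subset rfl

/-- Vertices, which are defined as exposed points, are the extreme points of a polytope. -/
theorem isVertex_iff {P : Set E} (hP : IsPolytope P) {v : E} :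
    IsVertex P v ↔ v ∈ P.extremePoints ℝ := by
  refine ⟨fun h => isExtreme_singleton.1 h.2.isExtreme, fun hv => ?_⟩
  refine ⟨Set.singleton_nonempty v, fun _ => ?_⟩
  obtain ⟨S, hS, hSne, rfl⟩ := hP
  have hvT : v ∉ convexHull ℝ (S \ {v}) := by
    have h := ((convex_convexHull ℝ S).mem_extremePoints_iff_mem_sdiff_convexHull_sdiff.1 hv).2
    exact fun hc => h (convexHull_mono (Set.sdiff_subset_sdiff_left (subset_convexHull ℝ S)) hc)
  have hfin : (S \ {v}).Finite := hS.subset Set.sdiff_subset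
  obtain ⟨l, c, hl, hlv⟩ := geometric_hahn_banach_closed_point (convex_convexHull ℝ (S \ {v}))
    (hfin.isClosed_convexHull ℝ) hvT
  have key : ∀ x ∈ convexHull ℝ S, l x ≤ l v ∧ (l x = l v → x = v) := by
    intro x hx
    rcases (S \ {v}).eq_empty_or_nonempty with h0 | h0
    · have : S ⊆ {v} := Set.sdiff_eq_empty.1 h0
      have hx' := convexHull_mono (𝕜 := ℝ) this hx
      rw [convexHull_singleton] at hx'
      simp only [Set.mem_singleton_iff] at hx'
      simp [hx']
    · have hx' : x ∈ convexHull ℝ (insert v (S \ {v})) :=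
        convexHull_mono (by simp) hx
      rw [convexHull_insert h0, mem_convexJoin] at hx'
      obtain ⟨a, rfl, z, hz, α, β, hα, hβ, hαβ, rfl⟩ := hx'
      have hz' : l z < l a := (hl z hz).trans hlv
      have he : l (α • a + β • z) = l a - β * (l a - l z) := by
        simp only [map_add, map_smul, smul_eq_mul]
        rw [show α = 1 - β by linarith]; ring
      refine ⟨by rw [he]; nlinarith, fun h => ?_⟩
      have hβ0 : β = 0 := by
        rw [he] at h
        have : β * (l a - l z) = 0 := by linarith
        rcases mul_eq_zero.1 this with h | h
        · exact h
        · linarith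
      have hα1 : α = 1 := by linarith
      simp [hβ0, hα1]
  refine ⟨l, ?_⟩
  ext x
  constructor
  · rintro rfl
    exact ⟨hv.1, fun y hy => (key y hy).1⟩
  · rintro ⟨hx, h⟩
    exact (key x hx).2 (le_antisymm (key x hx).1 (h v hv.1))

/-- A vertex where `f` is neither minimal nor maximal is not the only point at its height. -/
theorem IsVertex.exists_ne_of_between {P : Set E} (hP : IsPolytope P) {v : E} (hv : IsVertex P v)
    {f : E →ₗ[ℝ] ℝ} {p q : E} (hp : p ∈ P) (hq : q ∈ P) (hpv : f p < f v) (hvq : f v < f q) :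
    ∃ z ∈ P, z ≠ v ∧ f z = f v := by
  have hd : 0 < f q - f p := by linarith
  have h1 : 0 < (f q - f v) / (f q - f p) := div_pos (by linarith) hd
  have h2 : 0 < (f v - f p) / (f q - f p) := div_pos (by linarith) hd
  have h3 : (f q - f v) / (f q - f p) + (f v - f p) / (f q - f p) = 1 := by
    field_simp
    ring
  refine ⟨((f q - f v) / (f q - f p)) • p + ((f v - f p) / (f q - f p)) • q,
    hP.convex hp hq h1.le h2.le h3, fun h => ?_, ?_⟩
  · have := ((isVertex_iff hP).1 hv).2 hp hq ⟨_, _, h1, h2, h3, h⟩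
    rw [this] at hpv
    exact lt_irrefl _ hpv
  · simp only [map_add, map_smul, smul_eq_mul]
    field_simp
    ring

theorem IsPolytope.finite_vertices {P : Set E} (hP : IsPolytope P) : {v | IsVertex P v}.Finite :=
  hP.finite_extremePoints.subset fun _ hv => (isVertex_iff hP).1 hv

theorem IsPolytope.convexHull_vertices {P : Set E} (hP : IsPolytope P) :
    convexHull ℝ {v | IsVertex P v} = P := by
  have : {v | IsVertex P v} = P.extremePoints ℝ := Set.ext fun v => isVertex_iff hP
  rw [this]
  exact convexHull_extremePoints_eq hP.isCompact hP.convex hP.finite_extremePoints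

theorem isVertex_face_iff {P F : Set E} (hP : IsPolytope P) (hF : IsFace P F) {v : E} :
    IsVertex F v ↔ IsVertex P v ∧ v ∈ F := by
  rw [isVertex_iff hP, isVertex_iff (hF.isPolytope hP), hF.2.isExtreme.extremePoints_eq]
  exact and_comm

theorem IsPolytope.exists_isVertex {P : Set E} (hP : IsPolytope P) : ∃ v, IsVertex P v := by
  obtain ⟨v, hv⟩ := hP.isCompact.extremePoints_nonempty hP.nonempty
  exact ⟨v, (isVertex_iff hP).2 hv⟩

/-- The face of `P` on which the linear functional `l` is maximal. -/
def maxFace (P : Set E) (l : E →ₗ[ℝ] ℝ) : Set E := {x ∈ P | ∀ y ∈ P, l y ≤ l x}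

theorem IsFace.exists_eq_maxFace {P F : Set E} (hF : IsFace P F) :
    ∃ l : E →ₗ[ℝ] ℝ, F = maxFace P l := by
  obtain ⟨l, hl⟩ := hF.2 hF.1
  exact ⟨l, hl⟩

theorem IsEdge.symm {P : Set E} {u v : E} (h : IsEdge P u v) : IsEdge P v u :=
  ⟨h.1.symm, by rw [segment_symm]; exact h.2⟩

theorem IsAdmissible.ne {P : Set E} {f : E →ₗ[ℝ] ℝ} (hf : IsAdmissible P f) {u v : E}
    (h : IsEdge P u v) : f u ≠ f v := by
  intro he
  refine hf u v h ⟨f u, ?_⟩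
  rintro x ⟨a, b, -, -, hab, rfl⟩
  simp only [map_add, map_smul, smul_eq_mul, ← he]
  rw [← add_mul, hab, one_mul]

theorem IsAdmissible.neg {P : Set E} {f : E →ₗ[ℝ] ℝ} (hf : IsAdmissible P f) :
    IsAdmissible P (-f) := by
  rintro u v h ⟨c, hc⟩
  exact hf u v h ⟨-c, fun x hx => by rw [← hc x hx, LinearMap.neg_apply, neg_neg]⟩

theorem isSource_of_le {P : Set E} {f : E →ₗ[ℝ] ℝ} {s : E} (hs : IsVertex P s)
    (h : ∀ x ∈ P, f s ≤ f x) : IsSource P f s :=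
  ⟨hs, fun u hu => (h u (hu.1.2.subset (left_mem_segment ℝ u s))).not_gt hu.2⟩

theorem HasDirectedPath.cons {P : Set E} {f : E →ₗ[ℝ] ℝ} {k : ℕ} {u v w : E} (h : Arc P f u v)
    (hp : HasDirectedPath P f k v w) : HasDirectedPath P f (k + 1) u w := by
  obtain ⟨p, hp0, hpk, hpa⟩ := hp
  refine ⟨Fin.cons u p, rfl, ?_, fun i => ?_⟩
  · rw [← Fin.succ_last, Fin.cons_succ, hpk]
  · refine Fin.cases ?_ (fun j => ?_) i
    · simpa [hp0] using h
    · rw [← Fin.succ_castSucc, Fin.cons_succ, Fin.cons_succ]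
      exact hpa j

theorem HasDirectedPath.refl (P : Set E) (f : E →ₗ[ℝ] ℝ) (u : E) : HasDirectedPath P f 0 u u :=
  ⟨fun _ => u, rfl, rfl, fun i => i.elim0⟩

section FiniteDimensional

variable [FiniteDimensional ℝ E]

theorem isFace_maxFace {P : Set E} (hP : IsPolytope P) (l : E →ₗ[ℝ] ℝ) :
    IsFace P (maxFace P l) := by
  refine ⟨?_, fun _ => ⟨LinearMap.toContinuousLinearMap l, rfl⟩⟩
  obtain ⟨x, hx, h⟩ := hP.isCompact.exists_isMaxOn hP.nonempty
    (LinearMap.continuous_of_finiteDimensional l).continuousOn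
  exact ⟨x, hx, h⟩

/-- Every linear functional attains its maximum over a polytope at a vertex. -/
theorem IsPolytope.exists_vertex_isMax {P : Set E} (hP : IsPolytope P) (l : E →ₗ[ℝ] ℝ) :
    ∃ v, IsVertex P v ∧ ∀ x ∈ P, l x ≤ l v := by
  obtain ⟨v, hv⟩ := ((isFace_maxFace hP l).isPolytope hP).exists_isVertex
  exact ⟨v, ((isVertex_face_iff hP (isFace_maxFace hP l)).1 hv).1, hv.mem.2⟩

/-- A face of a face is a face. If `l₁` exposes `F` in `P` and `l₂` exposes `G` in `F`, then
`N l₁ + l₂` exposes `G` in `P` for large `N`. -/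
theorem IsFace.trans {P F G : Set E} (hP : IsPolytope P) (hF : IsFace P F) (hG : IsFace F G) :
    IsFace P G := by
  obtain ⟨l₁, h₁⟩ := hF.exists_eq_maxFace
  obtain ⟨l₂, h₂⟩ := hG.exists_eq_maxFace
  obtain ⟨z, hz⟩ := hG.1
  have hzF : z ∈ F := hG.subset hz
  have hz1 : ∀ y ∈ P, l₁ y ≤ l₁ z := by rw [h₁] at hzF; exact hzF.2
  have hz2 : ∀ y ∈ F, l₂ y ≤ l₂ z := by rw [h₂] at hz; exact hz.2
  -- one `N` serves for all the vertices of `P`, which are finitely many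
  obtain ⟨N, hN⟩ : ∃ N : ℝ, ∀ v, IsVertex P v → v ∉ F → l₂ v - l₂ z < N * (l₁ z - l₁ v) := by
    obtain ⟨N, hN⟩ := (hP.finite_vertices.image
      fun v => (|l₂ v - l₂ z| + 1) / (l₁ z - l₁ v)).bddAbove
    refine ⟨N, fun v hv hvF => ?_⟩
    have hlt : l₁ v < l₁ z := by
      refine lt_of_le_of_ne (hz1 v hv.mem) fun h => hvF ?_
      rw [h₁]
      exact ⟨hv.mem, fun y hy => h ▸ hz1 y hy⟩
    have := hN (Set.mem_image_of_mem _ hv)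
    rw [div_le_iff₀ (by linarith)] at this
    have h3 := le_abs_self (l₂ v - l₂ z)
    linarith
  have hl₁ : ∀ w ∈ F, l₁ w = l₁ z := fun w hw =>
    le_antisymm (hz1 w (hF.subset hw)) (by rw [h₁] at hw; exact hw.2 z (hF.subset hzF))
  have hface := isFace_maxFace hP (N • l₁ + l₂)
  set M := maxFace P (N • l₁ + l₂) with hM
  have hle : ∀ y ∈ P, (N • l₁ + l₂) y ≤ (N • l₁ + l₂) z := by
    obtain ⟨w, hw, hmax⟩ := hP.exists_vertex_isMax (N • l₁ + l₂)
    intro y hy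
    refine (hmax y hy).trans ?_
    simp only [LinearMap.add_apply, LinearMap.smul_apply, smul_eq_mul]
    by_cases hwF : w ∈ F
    · rw [hl₁ w hwF]
      linarith [hz2 w hwF]
    · linarith [hN w hw hwF]
  have hGM : G = M := by
    apply Set.Subset.antisymm
    · intro y hy
      have e1 := hl₁ y (hG.subset hy)
      have e2 : l₂ y = l₂ z :=
        le_antisymm (hz2 y (hG.subset hy)) (by rw [h₂] at hy; exact hy.2 z hzF)
      refine ⟨hF.subset (hG.subset hy), fun x hx => ?_⟩
      have := hle x hx
      simpa [e1, e2] using this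
    · rw [← (hface.isPolytope hP).convexHull_vertices]
      refine convexHull_min (fun w hw => ?_) ((hG.isPolytope (hF.isPolytope hP)).convex)
      have hwP := (isVertex_face_iff hP hface).1 hw
      have hwz := hwP.2.2 z (hF.subset hzF)
      simp only [LinearMap.add_apply, LinearMap.smul_apply, smul_eq_mul] at hwz
      by_cases hwF : w ∈ F
      · rw [hl₁ w hwF] at hwz
        rw [h₂]
        exact ⟨hwF, fun y hy => by linarith [hz2 y hy]⟩
      · linarith [hN w hwP.1 hwF]
  rw [hGM]
  exact hface

/-- A one-dimensional face with two different vertices is the edge that joins them. -/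
theorem IsFace.isEdge {P C : Set E} (hP : IsPolytope P) (hC : IsFace P C)
    (hdim : Module.finrank ℝ (vectorSpan ℝ C) ≤ 1) {u v : E} (hu : IsVertex P u)
    (hv : IsVertex P v) (huC : u ∈ C) (hvC : v ∈ C) (huv : u ≠ v) : IsEdge P u v := by
  refine ⟨huv, ?_⟩
  suffices h : segment ℝ u v = C by rwa [h]
  apply Set.Subset.antisymm ((hC.isPolytope hP).convex.segment_subset huC hvC)
  intro x hx
  have hvu : v - u ≠ 0 := sub_ne_zero.2 huv.symm
  have hmem : v - u ∈ vectorSpan ℝ C := vsub_mem_vectorSpan ℝ hvC huC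
  have hxm : x - u ∈ vectorSpan ℝ C := vsub_mem_vectorSpan ℝ hx huC
  obtain ⟨r, hr⟩ : ∃ r : ℝ, r • (v - u) = x - u := by
    obtain ⟨y, hy⟩ := finrank_le_one_iff.1 hdim
    obtain ⟨c, hc⟩ := hy ⟨_, hmem⟩
    obtain ⟨c', hc'⟩ := hy ⟨_, hxm⟩
    have hc := congrArg Subtype.val hc
    have hc' := congrArg Subtype.val hc'
    simp only [SetLike.val_smul] at hc hc'
    have hc0 : c ≠ 0 := by
      rintro rfl
      exact hvu (by rw [← hc, zero_smul])
    refine ⟨c' / c, ?_⟩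
    rw [← hc, ← hc', smul_smul, div_mul_cancel₀ _ hc0]
  have hxe : x = (1 - r) • u + r • v := by
    rw [smul_sub] at hr
    rw [sub_smul, one_smul]
    rw [eq_add_of_sub_eq hr.symm]
    abel
  have hue := ((isVertex_iff hP).1 hu).2
  have hve := ((isVertex_iff hP).1 hv).2
  have hxP := hC.subset hx
  rcases lt_or_ge r 0 with h0 | h0
  · exfalso
    -- `u` would lie strictly between `x` and `v`
    have h1r : (0 : ℝ) < 1 - r := by linarith
    have := hue hxP hv.mem ⟨1 / (1 - r), -r / (1 - r), by positivity,
      div_pos (by linarith) h1r, by field_simp; ring, by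
        rw [hxe, smul_add, smul_smul, smul_smul, add_assoc, ← add_smul]
        rw [show 1 / (1 - r) * (1 - r) = 1 by field_simp,
          show 1 / (1 - r) * r + -r / (1 - r) = 0 by field_simp; ring]
        simp⟩
    rw [this, sub_self] at hr
    rcases smul_eq_zero.1 hr with h | h
    · linarith
    · exact hvu h
  rcases le_or_gt r 1 with h1 | h1
  · exact ⟨1 - r, r, by linarith, h0, by ring, hxe.symm⟩
  · exfalso
    have hr0 : (0 : ℝ) < r := by linarith
    have := hve hu.mem hxP ⟨(r - 1) / r, 1 / r, div_pos (by linarith) hr0, by positivity,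
      by field_simp; ring, by
        rw [hxe, smul_add, smul_smul, smul_smul, ← add_assoc, ← add_smul]
        rw [show 1 / r * r = 1 by field_simp,
          show (r - 1) / r + 1 / r * (1 - r) = 0 by field_simp; ring]
        simp⟩
    exact huv this

/-- **Local improvement.** A vertex `v` that does not maximize `g` has a neighbour with a larger
value of `g`. The neighbours of `v` are read off from the vertex figure `Q`, which is the
central projection from `v` of the other vertices to a hyperplane that cuts `v` off. -/
theorem IsVertex.exists_isEdge {P : Set E} (hP : IsPolytope P) {v : E} (hv : IsVertex P v)
    (g : E →ₗ[ℝ] ℝ) (hg : ∃ y ∈ P, g v < g y) :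
    ∃ w, IsVertex P w ∧ IsEdge P v w ∧ g v < g w := by
  obtain ⟨l, hl⟩ := IsFace.exists_eq_maxFace hv
  have hlv : ∀ w ∈ P, w ≠ v → l w < l v := by
    intro w hw hwv
    have hvm : v ∈ maxFace P l := hl ▸ rfl
    refine lt_of_le_of_ne (hvm.2 w hw) fun h => hwv ?_
    have : w ∈ maxFace P l := ⟨hw, fun y hy => h ▸ hvm.2 y hy⟩
    rw [← hl] at this
    exact this
  set q : E → E := fun w => (l v - l w)⁻¹ • (w - v) with hq
  set V' : Set E := {w | IsVertex P w ∧ w ≠ v} with hV'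
  have hpos : ∀ w ∈ V', 0 < l v - l w := fun w hw => sub_pos.2 (hlv w hw.1.mem hw.2)
  have hlq : ∀ w ∈ V', l (q w) = -1 := by
    intro w hw
    have := hpos w hw
    simp only [hq, map_smul, map_sub, smul_eq_mul]
    field_simp
    ring
  have hqs : ∀ w ∈ V', (l v - l w) • q w = w - v := by
    intro w hw
    simp only [hq]
    rw [smul_smul, mul_inv_cancel₀ (hpos w hw).ne', one_smul]
  obtain ⟨w₁, hw₁, hmax⟩ := hP.exists_vertex_isMax g
  obtain ⟨y, hy, hgy⟩ := hg
  have hgw₁ : g v < g w₁ := hgy.trans_le (hmax y hy)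
  have hw₁V : w₁ ∈ V' := ⟨hw₁, fun h => by rw [h] at hgw₁; exact lt_irrefl _ hgw₁⟩
  have hQ : IsPolytope (convexHull ℝ (q '' V')) :=
    ⟨_, (hP.finite_vertices.subset fun w hw => hw.1).image q, ⟨_, Set.mem_image_of_mem q hw₁V⟩, rfl⟩
  obtain ⟨q₀, hq₀, hq₀max⟩ := hQ.exists_vertex_isMax g
  obtain ⟨w₀, hw₀, hqw₀⟩ := extremePoints_convexHull_subset ((isVertex_iff hQ).1 hq₀)
  have hgq₀ : 0 < g q₀ := by
    refine lt_of_lt_of_le ?_ (hq₀max _ (subset_convexHull ℝ _ (Set.mem_image_of_mem q hw₁V)))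
    simp only [hq, map_smul, map_sub, smul_eq_mul]
    exact mul_pos (inv_pos.2 (hpos _ hw₁V)) (sub_pos.2 hgw₁)
  obtain ⟨m, hm⟩ := IsFace.exists_eq_maxFace hq₀
  have hq₀m : q₀ ∈ maxFace (convexHull ℝ (q '' V')) m := hm ▸ rfl
  -- `c` vanishes on the ray from `v` in the direction `q₀` and is negative on the others
  set c : E →ₗ[ℝ] ℝ := m + m q₀ • l with hc
  have hcw : ∀ w ∈ V', c w - c v = (l v - l w) * (m (q w) - m q₀) := by
    intro w hw
    rw [← map_sub, ← hqs w hw, map_smul, smul_eq_mul, hc]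
    simp only [LinearMap.add_apply, LinearMap.smul_apply, smul_eq_mul, hlq w hw]
    ring
  have hmw : ∀ w ∈ V', m (q w) ≤ m q₀ := fun w hw =>
    hq₀m.2 _ (subset_convexHull ℝ _ (Set.mem_image_of_mem q hw))
  have hCf := isFace_maxFace hP c
  have hcv : ∀ x ∈ P, c x ≤ c v := by
    obtain ⟨w, hw, hwmax⟩ := hP.exists_vertex_isMax c
    intro x hx
    refine (hwmax x hx).trans ?_
    by_cases hwv : w = v
    · rw [hwv]
    · nlinarith [hcw w ⟨hw, hwv⟩, hmw w ⟨hw, hwv⟩, hpos w ⟨hw, hwv⟩]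
  have hvC : v ∈ maxFace P c := ⟨hv.mem, hcv⟩
  have hw₀C : w₀ ∈ maxFace P c := by
    refine ⟨hw₀.1.mem, fun x hx => (hcv x hx).trans ?_⟩
    have := hcw w₀ hw₀
    rw [hqw₀] at this
    linarith
  -- all vertices of the face exposed by `c` lie on that ray
  have hray : ∀ w, IsVertex P w → w ∈ maxFace P c → ∃ r : ℝ, w - v = r • q₀ := by
    intro w hw hwC
    by_cases hwv : w = v
    · exact ⟨0, by simp [hwv]⟩
    refine ⟨l v - l w, ?_⟩
    have hwV : w ∈ V' := ⟨hw, hwv⟩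
    have h1 := hcw w hwV
    have h2 := hwC.2 v hv.mem
    have h3 := hmw w hwV
    have h4 := hpos w hwV
    have h5 : m (q w) = m q₀ := by
      refine le_antisymm h3 (not_lt.1 fun h => ?_)
      nlinarith
    have : q w ∈ maxFace (convexHull ℝ (q '' V')) m :=
      ⟨subset_convexHull ℝ _ (Set.mem_image_of_mem q hwV), fun z hz => h5 ▸ hq₀m.2 z hz⟩
    rw [← hm] at this
    rw [← hqs w hwV, this]
  have hsub : maxFace P c ⊆ AffineSubspace.mk' v (ℝ ∙ q₀) := by
    have hpoly := hCf.isPolytope hP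
    rw [← hpoly.convexHull_vertices]
    refine convexHull_min (fun w hw => ?_) (AffineSubspace.convex _)
    have hw' := (isVertex_face_iff hP hCf).1 hw
    obtain ⟨r, hr⟩ := hray w hw'.1 hw'.2
    rw [SetLike.mem_coe, AffineSubspace.mem_mk', vsub_eq_sub, hr]
    exact Submodule.smul_mem _ _ (Submodule.mem_span_singleton_self q₀)
  have hdim : Module.finrank ℝ (vectorSpan ℝ (maxFace P c)) ≤ 1 := by
    have h1 : vectorSpan ℝ (maxFace P c) ≤ ℝ ∙ q₀ := by
      have := AffineSubspace.direction_le (affineSpan_le.2 hsub)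
      rwa [direction_affineSpan, AffineSubspace.direction_mk'] at this
    exact (Submodule.finrank_mono h1).trans ((finrank_span_le_card {q₀}).trans (by simp))
  refine ⟨w₀, hw₀.1, hCf.isEdge hP hdim hv hw₀.1 hvC hw₀C hw₀.2.symm, ?_⟩
  have : g (w₀ - v) = (l v - l w₀) * g q₀ := by
    rw [← hqs w₀ hw₀, map_smul, hqw₀, smul_eq_mul]
  rw [map_sub] at this
  nlinarith [mul_pos (hpos w₀ hw₀) hgq₀]

/-! ### The orientation by an admissible functional -/

theorem IsEdge.of_face {P F : Set E} (hP : IsPolytope P) (hF : IsFace P F) {u v : E}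
    (h : IsEdge F u v) : IsEdge P u v := ⟨h.1, hF.trans hP h.2⟩

theorem IsAdmissible.face {P F : Set E} (hP : IsPolytope P) (hF : IsFace P F) {f : E →ₗ[ℝ] ℝ}
    (hf : IsAdmissible P f) : IsAdmissible F f := fun u v h => hf u v (h.of_face hP hF)

/-- A polytope with at least two points has an edge at each vertex. -/
theorem IsVertex.exists_isEdge_of_ne {P : Set E} (hP : IsPolytope P) {v x : E}
    (hv : IsVertex P v) (hx : x ∈ P) (hxv : x ≠ v) : ∃ w, IsEdge P v w := by
  obtain ⟨l, hl⟩ := IsFace.exists_eq_maxFace hv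
  have hvm : v ∈ maxFace P l := hl ▸ rfl
  have hlt : l x < l v := by
    refine lt_of_le_of_ne (hvm.2 x hx) fun h => hxv ?_
    have : x ∈ maxFace P l := ⟨hx, fun y hy => h ▸ hvm.2 y hy⟩
    rw [← hl] at this
    exact this
  obtain ⟨w, -, hw, -⟩ := hv.exists_isEdge hP (-l) ⟨x, hx, by simpa using hlt⟩
  exact ⟨w, hw⟩

theorem IsAdmissible.subsingleton_of_const {P F : Set E} (hP : IsPolytope P) {f : E →ₗ[ℝ] ℝ}
    (hf : IsAdmissible P f) (hF : IsFace P F) (hconst : ∀ x ∈ F, ∀ y ∈ F, f x = f y) :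
    F.Subsingleton := by
  have hFp := hF.isPolytope hP
  obtain ⟨v, hv⟩ := hFp.exists_isVertex
  suffices h : ∀ x ∈ F, x = v from fun x hx y hy => (h x hx).trans (h y hy).symm
  intro x hx
  by_contra hxv
  obtain ⟨w, hw⟩ := hv.exists_isEdge_of_ne hFp hx hxv
  exact (hf.face hP hF).ne hw
    (hconst _ hv.mem _ (hw.2.subset (right_mem_segment ℝ v w)))

/-- The maximum of an admissible functional over a polytope is attained only once. -/
theorem IsAdmissible.eq_of_isMax {P : Set E} (hP : IsPolytope P) {f : E →ₗ[ℝ] ℝ}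
    (hf : IsAdmissible P f) {u v : E} (hu : u ∈ P) (hv : v ∈ P) (humax : ∀ x ∈ P, f x ≤ f u)
    (hvmax : ∀ x ∈ P, f x ≤ f v) : u = v :=
  hf.subsingleton_of_const hP (isFace_maxFace hP f)
    (fun x hx y hy => le_antisymm (hy.2 x hx.1) (hx.2 y hy.1)) ⟨hu, humax⟩ ⟨hv, hvmax⟩

theorem IsAdmissible.eq_of_isMin {P : Set E} (hP : IsPolytope P) {f : E →ₗ[ℝ] ℝ}
    (hf : IsAdmissible P f) {u v : E} (hu : u ∈ P) (hv : v ∈ P) (humin : ∀ x ∈ P, f u ≤ f x)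
    (hvmin : ∀ x ∈ P, f v ≤ f x) : u = v :=
  hf.neg.eq_of_isMax hP hu hv (fun x hx => neg_le_neg (humin x hx))
    (fun x hx => neg_le_neg (hvmin x hx))

theorem IsSource.le {P : Set E} (hP : IsPolytope P) {f : E →ₗ[ℝ] ℝ} {s : E} (hs : IsSource P f s)
    {x : E} (hx : x ∈ P) : f s ≤ f x := by
  by_contra! h
  obtain ⟨w, -, he, hw⟩ := hs.1.exists_isEdge hP (-f) ⟨x, hx, by simpa using h⟩
  exact hs.2 w ⟨he.symm, by simpa using hw⟩

theorem IsSink.le {P : Set E} (hP : IsPolytope P) {f : E →ₗ[ℝ] ℝ} {t : E} (ht : IsSink P f t)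
    {x : E} (hx : x ∈ P) : f x ≤ f t := by
  by_contra! h
  obtain ⟨w, -, he, hw⟩ := ht.1.exists_isEdge hP f ⟨x, hx, h⟩
  exact ht.2 w ⟨he, hw⟩

theorem IsSource.lt {P : Set E} (hP : IsPolytope P) {f : E →ₗ[ℝ] ℝ} (hf : IsAdmissible P f) {s : E}
    (hs : IsSource P f s) {x : E} (hx : x ∈ P) (hxs : x ≠ s) : f s < f x :=
  lt_of_le_of_ne (hs.le hP hx) fun h => hxs
    (hf.eq_of_isMin hP hx hs.1.mem (fun _ hy => h ▸ hs.le hP hy) fun _ hy => hs.le hP hy)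

theorem IsSink.lt {P : Set E} (hP : IsPolytope P) {f : E →ₗ[ℝ] ℝ} (hf : IsAdmissible P f) {t : E}
    (ht : IsSink P f t) {x : E} (hx : x ∈ P) (hxt : x ≠ t) : f x < f t :=
  lt_of_le_of_ne (ht.le hP hx) fun h => hxt
    (hf.eq_of_isMax hP hx ht.1.mem (fun _ hy => h ▸ ht.le hP hy) fun _ hy => ht.le hP hy)

theorem IsSource.face {P F : Set E} (hP : IsPolytope P) (hF : IsFace P F) {f : E →ₗ[ℝ] ℝ} {s : E}
    (hs : IsSource P f s) (hsF : s ∈ F) : IsSource F f s :=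
  ⟨(isVertex_face_iff hP hF).2 ⟨hs.1, hsF⟩, fun u hu => hs.2 u ⟨hu.1.of_face hP hF, hu.2⟩⟩

theorem IsSink.face {P F : Set E} (hP : IsPolytope P) (hF : IsFace P F) {f : E →ₗ[ℝ] ℝ} {t : E}
    (ht : IsSink P f t) (htF : t ∈ F) : IsSink F f t :=
  ⟨(isVertex_face_iff hP hF).2 ⟨ht.1, htF⟩, fun u hu => ht.2 u ⟨hu.1.of_face hP hF, hu.2⟩⟩

/-! ### Directed paths -/

theorem HasDirectedPath.of_face {P F : Set E} (hP : IsPolytope P) (hF : IsFace P F)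
    {f : E →ₗ[ℝ] ℝ} {k : ℕ} {u v : E} (h : HasDirectedPath F f k u v) :
    HasDirectedPath P f k u v := by
  obtain ⟨p, h0, hk, ha⟩ := h
  exact ⟨p, h0, hk, fun i => ⟨(ha i).1.of_face hP hF, (ha i).2⟩⟩

end FiniteDimensional
end MonotoneDiameter

namespace MonotoneDiameter

/-! ### Presentations of polytopes by their facets -/

/-- A finitely generated cone is an intersection of finitely many half-spaces, by Fourier-Motzkin
elimination: `x` lies in the cone over `insert v S` iff `x - r • v` lies in the cone over `S` for
some `r ≥ 0`, and `r` can be eliminated from the inequalities that express this. -/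
theorem exists_halfspaces_span_nnreal {V : Type*} [AddCommGroup V] [Module ℝ V]
    [FiniteDimensional ℝ V] {S : Set V} (hS : S.Finite) :
    ∃ A : Finset (V →ₗ[ℝ] ℝ), ∀ x, x ∈ Submodule.span NNReal S ↔ ∀ a ∈ A, a x ≤ 0 := by
  classical
  induction S, hS using Set.Finite.induction_on with
  | empty =>
    let B := Module.finBasis ℝ V
    refine ⟨Finset.univ.image B.coord ∪ Finset.univ.image fun i => -B.coord i, fun x => ?_⟩
    rw [Submodule.span_empty, Submodule.mem_bot]
    constructor
    · rintro rfl a -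
      simp
    · intro h
      refine B.ext_elem fun i => ?_
      have h1 := h (B.coord i) (by simp)
      have h2 := h (-B.coord i) (by simp)
      simp only [LinearMap.neg_apply, Module.Basis.coord_apply] at h1 h2
      rw [map_zero, Finsupp.zero_apply]
      linarith
  | @insert v S _ _ ih =>
    obtain ⟨A, hA⟩ := ih
    refine ⟨A.filter (fun a => a v ≤ 0) ∪
      ((A.filter fun a => 0 < a v) ×ˢ (A.filter fun a => a v < 0)).image
        fun p => p.1 v • p.2 - p.2 v • p.1, fun x => ?_⟩
    have hstep : x ∈ Submodule.span NNReal (insert v S) ↔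
        ∃ r : ℝ, 0 ≤ r ∧ ∀ a ∈ A, a x ≤ r * a v := by
      rw [Submodule.mem_span_insert]
      constructor
      · rintro ⟨r, z, hz, rfl⟩
        refine ⟨r, r.2, fun a ha => ?_⟩
        have h1 := (hA z).1 hz a ha
        have h2 : a (r • v) = (r : ℝ) * a v := by
          rw [NNReal.smul_def, map_smul, smul_eq_mul]
        rw [map_add, h2]
        linarith
      · rintro ⟨r, hr, h⟩
        lift r to NNReal using hr
        refine ⟨r, x - (r : ℝ) • v, (hA _).2 fun a ha => ?_, ?_⟩
        · rw [map_sub, map_smul, smul_eq_mul]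
          linarith [h a ha]
        · rw [NNReal.smul_def, add_sub_cancel]
    rw [hstep]
    constructor
    · rintro ⟨r, hr, h⟩ a ha
      simp only [Finset.mem_union, Finset.mem_filter, Finset.mem_image, Finset.mem_product] at ha
      rcases ha with ⟨ha, hav⟩ | ⟨⟨p, n⟩, ⟨⟨hp, hpv⟩, hn, hnv⟩, rfl⟩
      · nlinarith [h a ha]
      · simp only [LinearMap.sub_apply, LinearMap.smul_apply, smul_eq_mul] at hpv hnv ⊢
        nlinarith [h p hp, h n hn]
    · intro h
      -- the largest of the lower bounds for `r` is a solution
      obtain ⟨r, hrL, hrmax⟩ := (insert 0 ((A.filter fun a => 0 < a v).image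
        fun a => a x / a v)).exists_max_image id (Finset.insert_nonempty _ _)
      simp only [id] at hrmax
      have hr0 : 0 ≤ r := hrmax 0 (Finset.mem_insert_self _ _)
      refine ⟨r, hr0, fun a ha => ?_⟩
      rcases lt_trichotomy (a v) 0 with hav | hav | hav
      · rw [Finset.mem_insert, Finset.mem_image] at hrL
        rcases hrL with rfl | ⟨p, hp, rfl⟩
        · rw [zero_mul]
          exact h a (Finset.mem_union_left _ (Finset.mem_filter.2 ⟨ha, hav.le⟩))
        · have := h (p v • a - a v • p) (Finset.mem_union_right _ (Finset.mem_image.2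
            ⟨(p, a), Finset.mem_product.2 ⟨hp, Finset.mem_filter.2 ⟨ha, hav⟩⟩, rfl⟩))
          have hpv := (Finset.mem_filter.1 hp).2
          simp only [LinearMap.sub_apply, LinearMap.smul_apply, smul_eq_mul] at this
          rw [div_mul_eq_mul_div, le_div_iff₀ hpv]
          linarith
      · rw [hav, mul_zero]
        exact h a (Finset.mem_union_left _ (Finset.mem_filter.2 ⟨ha, hav.le⟩))
      · have := hrmax (a x / a v) (Finset.mem_insert_of_mem (Finset.mem_image.2
          ⟨a, Finset.mem_filter.2 ⟨ha, hav⟩, rfl⟩))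
        rwa [div_le_iff₀ hav] at this

variable {E : Type*} [NormedAddCommGroup E] [NormedSpace ℝ E]

/-- The convex hull of `S` is the section at height `1` of the cone over `S × {1}`. -/
theorem mem_span_homogenize_iff {S : Set E} {x : E} :
    (x, (1 : ℝ)) ∈ Submodule.span NNReal ((fun y : E => (y, (1 : ℝ))) '' S) ↔
      x ∈ convexHull ℝ S := by
  set C := Submodule.span NNReal ((fun y : E => (y, (1 : ℝ))) '' S) with hC
  constructor
  · intro hx
    obtain ⟨c, hc, hsum⟩ := Submodule.mem_span_set.1 hx
    rw [Finsupp.sum] at hsum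
    have hfst := congrArg Prod.fst hsum
    have hsnd := congrArg Prod.snd hsum
    rw [Prod.fst_sum] at hfst
    rw [Prod.snd_sum] at hsnd
    simp only [Prod.smul_fst, Prod.smul_snd, NNReal.smul_def] at hfst hsnd
    have hmem : ∀ i ∈ c.support, i.1 ∈ S ∧ i.2 = 1 := by
      intro i hi
      obtain ⟨y, hy, rfl⟩ := hc hi
      exact ⟨hy, rfl⟩
    rw [← hfst]
    refine (convex_convexHull ℝ S).sum_mem (fun i _ => (c i).2) ?_
      fun i hi => subset_convexHull ℝ S (hmem i hi).1
    rw [← hsnd]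
    exact Finset.sum_congr rfl fun i hi => by rw [(hmem i hi).2, smul_eq_mul, mul_one]
  · have hconv : Convex ℝ {y : E | (y, (1 : ℝ)) ∈ C} := by
      intro y hy z hz α β hα hβ hαβ
      have h1 : (α.toNNReal • y, (α : ℝ)) ∈ C := by
        have := C.smul_mem α.toNNReal hy
        rwa [Prod.smul_mk, NNReal.smul_def α.toNNReal (1 : ℝ), Real.coe_toNNReal α hα,
          smul_eq_mul, mul_one] at this
      have h2 : (β.toNNReal • z, (β : ℝ)) ∈ C := by
        have := C.smul_mem β.toNNReal hz
        rwa [Prod.smul_mk, NNReal.smul_def β.toNNReal (1 : ℝ), Real.coe_toNNReal β hβ,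
          smul_eq_mul, mul_one] at this
      have h3 := C.add_mem h1 h2
      rw [Prod.mk_add_mk, hαβ, NNReal.smul_def, NNReal.smul_def, Real.coe_toNNReal α hα,
        Real.coe_toNNReal β hβ] at h3
      exact h3
    have hsub : S ⊆ {y : E | (y, (1 : ℝ)) ∈ C} :=
      fun y hy => Submodule.subset_span (Set.mem_image_of_mem _ hy)
    exact fun hx => convexHull_min hsub hconv hx

/-- A polytope is an intersection of finitely many half-spaces. -/
theorem IsPolytope.exists_halfspaces [FiniteDimensional ℝ E] {P : Set E} (hP : IsPolytope P) :
    ∃ J : Finset ((E →ₗ[ℝ] ℝ) × ℝ), ∀ x, x ∈ P ↔ ∀ j ∈ J, j.1 x ≤ j.2 := by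
  classical
  obtain ⟨S, hS, -, rfl⟩ := hP
  obtain ⟨A, hA⟩ := exists_halfspaces_span_nnreal (hS.image fun x : E => (x, (1 : ℝ)))
  refine ⟨A.image fun a => (a ∘ₗ LinearMap.inl ℝ E ℝ, -a (0, 1)), fun x => ?_⟩
  rw [← mem_span_homogenize_iff, hA, Finset.forall_mem_image]
  refine forall₂_congr fun a _ => ?_
  have : a (x, 1) = a (x, 0) + a (0, 1) := by rw [← map_add]; simp
  simp only [LinearMap.comp_apply, LinearMap.inl_apply, this]
  constructor <;> intro h <;> linarith

/-- `P` is the set of solutions, within its affine hull, of the inequalities `j.1 x ≤ j.2` with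
`j ∈ J`; moreover all of them are strict somewhere on `P`, and each of them is
tight at a point of `P` where the others are strict. The sets `tightFace P j` with `j ∈ J` are then
the facets of `P`, without repetition. -/
structure Presents (P : Set E) (J : Finset ((E →ₗ[ℝ] ℝ) × ℝ)) : Prop where
  mem_iff : ∀ x, x ∈ P ↔ x ∈ affineSpan ℝ P ∧ ∀ j ∈ J, j.1 x ≤ j.2
  interior : ∃ p ∈ P, ∀ j ∈ J, j.1 p < j.2
  tight : ∀ j ∈ J, ∃ y ∈ P, j.1 y = j.2 ∧ ∀ k ∈ J, k ≠ j → k.1 y < k.2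

/-- The part of `P` where the inequality `j.1 x ≤ j.2` is tight. -/
def tightFace (P : Set E) (j : (E →ₗ[ℝ] ℝ) × ℝ) : Set E := {x ∈ P | j.1 x = j.2}

/-- A finite system of inequalities for `P` contains an irredundant one: any minimal subsystem
that still defines `P` will do. -/
theorem exists_presents {P : Set E} (hP : IsPolytope P) {J : Finset ((E →ₗ[ℝ] ℝ) × ℝ)}
    (hJ : ∀ x, x ∈ P ↔ x ∈ affineSpan ℝ P ∧ ∀ j ∈ J, j.1 x ≤ j.2) :
    ∃ J' ⊆ J, Presents P J' := by
  classical
  obtain ⟨J', hJ', hmin⟩ := (J.powerset.filter fun K =>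
    ∀ x, x ∈ P ↔ x ∈ affineSpan ℝ P ∧ ∀ j ∈ K, j.1 x ≤ j.2).exists_min_image Finset.card
    ⟨J, Finset.mem_filter.2 ⟨Finset.mem_powerset_self J, hJ⟩⟩
  obtain ⟨hsub, hmem⟩ := Finset.mem_filter.1 hJ'
  rw [Finset.mem_powerset] at hsub
  -- omitting `j` admits a point that violates `j` alone
  have hviol : ∀ j ∈ J', ∃ x ∈ affineSpan ℝ P, j.2 < j.1 x ∧ ∀ k ∈ J', k ≠ j → k.1 x ≤ k.2 := by
    intro j hj
    by_contra! hcon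
    have : J'.erase j ∈ J.powerset.filter fun K =>
        ∀ x, x ∈ P ↔ x ∈ affineSpan ℝ P ∧ ∀ j ∈ K, j.1 x ≤ j.2 := by
      refine Finset.mem_filter.2 ⟨Finset.mem_powerset.2 ((Finset.erase_subset j J').trans hsub),
        fun x => ⟨fun hx => ⟨((hmem x).1 hx).1, fun k hk =>
          ((hmem x).1 hx).2 k (Finset.mem_of_mem_erase hk)⟩, fun ⟨hx, hk⟩ => ?_⟩⟩
      refine (hmem x).2 ⟨hx, fun k hkJ => ?_⟩
      by_cases hkj : k = j
      · subst hkj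
        by_contra! hlt
        obtain ⟨k', hk', hne, hlt'⟩ := hcon x hx hlt
        exact (hk k' (Finset.mem_erase.2 ⟨hne, hk'⟩)).not_gt hlt'
      · exact hk k (Finset.mem_erase.2 ⟨hkj, hkJ⟩)
    exact (Finset.card_erase_lt_of_mem hj).not_ge (hmin _ this)
  have hstrict : ∀ j ∈ J', ∃ p ∈ P, j.1 p < j.2 := by
    intro j hj
    by_contra! hcon
    obtain ⟨x, hx, hlt, -⟩ := hviol j hj
    have hle : affineSpan ℝ P ≤ (affineSpan ℝ ({j.2} : Set ℝ)).comap j.1.toAffineMap := by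
      rw [affineSpan_le]
      intro p hp
      have : j.1 p = j.2 := le_antisymm (((hmem p).1 hp).2 j hj) (hcon p hp)
      simp [this]
    have := hle hx
    simp at this
    exact hlt.ne' this
  have hinter : ∃ p ∈ P, ∀ j ∈ J', j.1 p < j.2 := by
    have key : ∀ K ⊆ J', ∃ p ∈ P, ∀ j ∈ K, j.1 p < j.2 := by
      intro K
      induction K using Finset.induction_on with
      | empty =>
        obtain ⟨p, hp⟩ := hP.nonempty
        exact fun _ => ⟨p, hp, by simp⟩
      | insert j K _ ih =>
        intro hK
        obtain ⟨hjJ, hKJ⟩ := Finset.insert_subset_iff.1 hK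
        obtain ⟨p, hp, hpK⟩ := ih hKJ
        obtain ⟨q, hq, hqj⟩ := hstrict j hjJ
        refine ⟨(1 / 2 : ℝ) • p + (1 / 2 : ℝ) • q,
          hP.convex hp hq (by norm_num) (by norm_num) (by norm_num), fun k hk => ?_⟩
        simp only [map_add, map_smul, smul_eq_mul]
        rcases Finset.mem_insert.1 hk with rfl | hkK
        · linarith [((hmem p).1 hp).2 k hjJ]
        · linarith [hpK k hkK, ((hmem q).1 hq).2 k (hKJ hkK)]
    exact key J' subset_rfl
  refine ⟨J', hsub, hmem, hinter, fun j hj => ?_⟩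
  obtain ⟨p, hp, hpJ⟩ := hinter
  obtain ⟨x, hx, hlt, hxk⟩ := hviol j hj
  -- the segment from `p` to `x` leaves `P` through the hyperplane of `j`
  have hd : 0 < j.1 x - j.1 p := by linarith [hpJ j hj]
  set r : ℝ := (j.2 - j.1 p) / (j.1 x - j.1 p) with hr
  have hr0 : 0 < r := div_pos (by linarith [hpJ j hj]) hd
  have hr1 : r < 1 := by rw [hr, div_lt_one hd]; linarith
  have hval : ∀ k : E →ₗ[ℝ] ℝ, k (AffineMap.lineMap p x r) = k p + r * (k x - k p) := by
    intro k
    simp only [AffineMap.lineMap_apply, vsub_eq_sub, vadd_eq_add, map_add, map_smul, map_sub,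
      smul_eq_mul]
    ring
  have hj0 : j.1 (AffineMap.lineMap p x r) = j.2 := by
    rw [hval, hr, div_mul_cancel₀ _ hd.ne']
    ring
  have hk0 : ∀ k ∈ J', k ≠ j → k.1 (AffineMap.lineMap p x r) < k.2 := by
    intro k hk hkj
    rw [hval]
    nlinarith [hpJ k hk, hxk k hk hkj]
  refine ⟨AffineMap.lineMap p x r, (hmem _).2
    ⟨AffineMap.lineMap_mem r (subset_affineSpan ℝ P hp) hx, fun k hk => ?_⟩, hj0, hk0⟩
  by_cases hkj : k = j
  · rw [hkj, hj0]
  · exact (hk0 k hk hkj).le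

namespace Presents

variable {P : Set E} {J : Finset ((E →ₗ[ℝ] ℝ) × ℝ)}

theorem le (h : Presents P J) {x : E} (hx : x ∈ P) {j : (E →ₗ[ℝ] ℝ) × ℝ} (hj : j ∈ J) :
    j.1 x ≤ j.2 := ((h.mem_iff x).1 hx).2 j hj

theorem injOn_tightFace (h : Presents P J) : Set.InjOn (tightFace P) J := by
  intro j hj k hk hjk
  by_contra hne
  obtain ⟨y, hy, hyj, hyk⟩ := h.tight j hj
  have : y ∈ tightFace P k := hjk ▸ ⟨hy, hyj⟩
  exact (hyk k hk (Ne.symm hne)).ne this.2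

theorem tightFace_eq_maxFace (h : Presents P J) {j : (E →ₗ[ℝ] ℝ) × ℝ} (hj : j ∈ J) :
    tightFace P j = maxFace P j.1 := by
  obtain ⟨y, hy, hyj, -⟩ := h.tight j hj
  ext x
  constructor
  · rintro ⟨hx, hxj⟩
    exact ⟨hx, fun z hz => hxj ▸ h.le hz hj⟩
  · rintro ⟨hx, hxm⟩
    exact ⟨hx, le_antisymm (h.le hx hj) (hyj ▸ hxm y hy)⟩

variable [FiniteDimensional ℝ E]

/-- From a point of `P` one can move a little in every direction of the affine hull that increases
none of the tight functionals. -/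
theorem exists_add_smul_mem (h : Presents P J) {x w : E} (hx : x ∈ P) (hw : w ∈ vectorSpan ℝ P)
    (hle : ∀ j ∈ J, j.1 x = j.2 → j.1 w ≤ 0) : ∃ ε : ℝ, 0 < ε ∧ x + ε • w ∈ P := by
  have hsmall : ∀ᶠ ε : ℝ in nhdsWithin 0 (Set.Ioi 0), ∀ j ∈ J, j.1 (x + ε • w) ≤ j.2 := by
    rw [Filter.eventually_all_finset]
    intro j hj
    rcases (h.le hx hj).lt_or_eq with hlt | heq
    · have hc : Filter.Tendsto (fun ε : ℝ => j.1 (x + ε • w)) (nhds 0)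
          (nhds (j.1 (x + (0 : ℝ) • w))) := by
        have : Continuous fun ε : ℝ => j.1 (x + ε • w) :=
          j.1.continuous_of_finiteDimensional.comp (by fun_prop)
        exact this.tendsto 0
      rw [zero_smul, add_zero] at hc
      exact ((hc.eventually (gt_mem_nhds hlt)).filter_mono nhdsWithin_le_nhds).mono
        fun _ h => h.le
    · filter_upwards [self_mem_nhdsWithin] with ε hε
      rw [map_add, map_smul, smul_eq_mul, heq]
      nlinarith [hle j hj heq, Set.mem_Ioi.1 hε]
  obtain ⟨ε, hε, hpos⟩ := (hsmall.and self_mem_nhdsWithin).exists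
  refine ⟨ε, hpos, (h.mem_iff _).2 ⟨?_, hε⟩⟩
  rw [add_comm]
  refine AffineSubspace.vadd_mem_of_mem_direction ?_ (subset_affineSpan ℝ P hx)
  rw [direction_affineSpan]
  exact Submodule.smul_mem _ _ hw

/-- The functionals that are tight at a vertex have no common zero besides `0` in the direction
space of the polytope. -/
theorem eq_zero_of_tight (h : Presents P J) (hP : IsPolytope P) {v w : E} (hv : IsVertex P v)
    (hw : w ∈ vectorSpan ℝ P) (hzero : ∀ j ∈ J, j.1 v = j.2 → j.1 w = 0) : w = 0 := by
  obtain ⟨ε, hε, h1⟩ := h.exists_add_smul_mem hv.mem hw fun j hj hjv => (hzero j hj hjv).le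
  obtain ⟨δ, hδ, h2⟩ := h.exists_add_smul_mem hv.mem (Submodule.neg_mem _ hw)
    fun j hj hjv => by rw [map_neg, hzero j hj hjv, neg_zero]
  have hmid := ((isVertex_iff hP).1 hv).2 h1 h2 ⟨δ / (ε + δ), ε / (ε + δ), by positivity,
    by positivity, by field_simp; ring, by
      rw [smul_add, smul_add, add_add_add_comm, ← add_smul, smul_smul, smul_smul, smul_neg,
        ← sub_eq_add_neg, ← sub_smul,
        show δ / (ε + δ) + ε / (ε + δ) = 1 by field_simp; ring,
        show δ / (ε + δ) * ε - ε / (ε + δ) * δ = 0 by ring]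
      simp⟩
  have : ε • w = 0 := by simpa using hmid
  exact (smul_eq_zero.1 this).resolve_left hε.ne'

open Classical in
/-- At least `d` facets pass through each vertex of a `d`-dimensional polytope. -/
theorem finrank_le_card (h : Presents P J) (hP : IsPolytope P) {v : E} (hv : IsVertex P v) :
    affDim P ≤ (J.filter fun j => j.1 v = j.2).card := by
  let φ : vectorSpan ℝ P →ₗ[ℝ] ({j // j ∈ J.filter fun j => j.1 v = j.2} → ℝ) :=
    LinearMap.pi fun j => j.1.1 ∘ₗ (vectorSpan ℝ P).subtype
  have hinj : Function.Injective φ := by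
    rw [injective_iff_map_eq_zero]
    intro w hw
    refine Subtype.ext (h.eq_zero_of_tight hP hv w.2 fun j hj hjv => ?_)
    exact congrFun hw ⟨j, Finset.mem_filter.2 ⟨hj, hjv⟩⟩
  have := LinearMap.finrank_le_finrank_of_injective hinj
  rwa [Module.finrank_fintype_fun_eq_card, Fintype.card_coe] at this

theorem isFace_tightFace (h : Presents P J) (hP : IsPolytope P) {j : (E →ₗ[ℝ] ℝ) × ℝ}
    (hj : j ∈ J) : IsFace P (tightFace P j) := by
  rw [h.tightFace_eq_maxFace hj]
  exact isFace_maxFace hP j.1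

theorem vectorSpan_tightFace (h : Presents P J) {j : (E →ₗ[ℝ] ℝ) × ℝ} (hj : j ∈ J) :
    vectorSpan ℝ (tightFace P j) = vectorSpan ℝ P ⊓ LinearMap.ker j.1 := by
  apply le_antisymm
  · refine le_inf (vectorSpan_mono ℝ fun x hx => hx.1) ?_
    rw [vectorSpan_def, Submodule.span_le]
    rintro _ ⟨x, hx, y, hy, rfl⟩
    simp only [vsub_eq_sub, SetLike.mem_coe, LinearMap.mem_ker, map_sub, hx.2, hy.2, sub_self]
  · rintro w ⟨hw, hwj⟩
    rw [SetLike.mem_coe, LinearMap.mem_ker] at hwj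
    obtain ⟨y, hy, hyj, hyk⟩ := h.tight j hj
    obtain ⟨ε, hε, hmem⟩ := h.exists_add_smul_mem hy hw fun k hk hky => by
      by_cases hkj : k = j
      · rw [hkj, hwj]
      · exact absurd hky (hyk k hk hkj).ne
    have h1 : y + ε • w ∈ tightFace P j := ⟨hmem, by rw [map_add, map_smul, hwj, hyj]; simp⟩
    have h2 := vsub_mem_vectorSpan ℝ h1 (show y ∈ tightFace P j from ⟨hy, hyj⟩)
    have h3 := Submodule.smul_mem _ ε⁻¹ h2
    rwa [vsub_eq_sub, add_sub_cancel_left, smul_smul, inv_mul_cancel₀ hε.ne', one_smul] at h3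

theorem affDim_tightFace (h : Presents P J) {j : (E →ₗ[ℝ] ℝ) × ℝ} (hj : j ∈ J) :
    affDim (tightFace P j) + 1 = affDim P := by
  obtain ⟨y, hy, hyj, -⟩ := h.tight j hj
  obtain ⟨p, hp, hpJ⟩ := h.interior
  have hne : j.1 ∘ₗ (vectorSpan ℝ P).subtype ≠ 0 := by
    intro h0
    have := LinearMap.congr_fun h0 ⟨y - p, vsub_mem_vectorSpan ℝ hy hp⟩
    simp only [LinearMap.comp_apply, Submodule.subtype_apply, map_sub, LinearMap.zero_apply] at this
    linarith [hpJ j hj]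
  have h1 := Module.Dual.finrank_ker_add_one_of_ne_zero hne
  rw [affDim, h.vectorSpan_tightFace hj, affDim, ← h1]
  congr 1
  rw [LinearMap.ker_comp, ← Submodule.map_comap_subtype]
  exact Submodule.finrank_map_subtype_eq _ _

theorem isFacet_tightFace (h : Presents P J) (hP : IsPolytope P) {j : (E →ₗ[ℝ] ℝ) × ℝ}
    (hj : j ∈ J) : IsFacet P (tightFace P j) :=
  ⟨h.isFace_tightFace hP hj, h.affDim_tightFace hj⟩

open Classical in
/-- A facet is presented by some of the inequalities of the other facets. -/
theorem exists_presents_tightFace (h : Presents P J) (hP : IsPolytope P)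
    {j : (E →ₗ[ℝ] ℝ) × ℝ} (hj : j ∈ J) :
    ∃ K ⊆ J.erase j, Presents (tightFace P j) K := by
  refine exists_presents ((h.isFace_tightFace hP hj).isPolytope hP) fun x => ⟨fun hx =>
    ⟨subset_affineSpan ℝ _ hx, fun k hk => h.le hx.1 (Finset.mem_of_mem_erase hk)⟩, ?_⟩
  rintro ⟨hx, hk⟩
  have hxj : j.1 x = j.2 := by
    have hle : affineSpan ℝ (tightFace P j) ≤
        (affineSpan ℝ ({j.2} : Set ℝ)).comap j.1.toAffineMap := by
      rw [affineSpan_le]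
      intro p hp
      simp [hp.2]
    have := hle hx
    simpa using this
  refine ⟨(h.mem_iff x).2 ⟨affineSpan_mono ℝ (fun y hy => hy.1) hx, fun k hkJ => ?_⟩, hxj⟩
  by_cases hkj : k = j
  · rw [hkj, hxj]
  · exact hk k (Finset.mem_erase.2 ⟨hkj, hkJ⟩)

end Presents

variable [FiniteDimensional ℝ E]

/-- A polytope with `n` facets has a presentation by at most `n` inequalities. -/
theorem IsPolytope.exists_presents {P : Set E} (hP : IsPolytope P) :
    ∃ J, Presents P J ∧ (J.card : ℕ∞) ≤ {F | IsFacet P F}.encard := by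
  obtain ⟨J₀, hJ₀⟩ := hP.exists_halfspaces
  obtain ⟨J, -, hJ⟩ := MonotoneDiameter.exists_presents hP (J := J₀) fun x =>
    ⟨fun hx => ⟨subset_affineSpan ℝ P hx, (hJ₀ x).1 hx⟩, fun hx => (hJ₀ x).2 hx.2⟩
  refine ⟨J, hJ, ?_⟩
  rw [← Set.encard_coe_eq_coe_finsetCard, ← hJ.injOn_tightFace.encard_image]
  refine Set.encard_le_encard ?_
  rintro _ ⟨j, hj, rfl⟩
  exact hJ.isFacet_tightFace hP hj

/-- Two vertices form an edge if they lie on common facets whose functionals, together with one more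
functional `h`, have no common zero besides `0` in the direction space. -/
theorem isEdge_of_common_tight {P : Set E} (hP : IsPolytope P) {J : Finset ((E →ₗ[ℝ] ℝ) × ℝ)}
    (hJ : Presents P J) {T : Finset ((E →ₗ[ℝ] ℝ) × ℝ)} (hT : T ⊆ J) (h : E →ₗ[ℝ] ℝ) {u v : E}
    (hu : IsVertex P u) (hv : IsVertex P v) (huv : u ≠ v) (huT : ∀ j ∈ T, j.1 u = j.2)
    (hvT : ∀ j ∈ T, j.1 v = j.2)
    (hzero : ∀ w ∈ vectorSpan ℝ P, (∀ j ∈ T, j.1 w = 0) → h w = 0 → w = 0) : IsEdge P u v := by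
  set l : E →ₗ[ℝ] ℝ := ∑ j ∈ T, j.1 with hl
  have hle : ∀ x ∈ P, l x ≤ ∑ j ∈ T, j.2 := fun x hx => by
    rw [hl, LinearMap.sum_apply]
    exact Finset.sum_le_sum fun j hj => hJ.le hx (hT hj)
  have hmem : ∀ x ∈ P, (∀ j ∈ T, j.1 x = j.2) → x ∈ maxFace P l := fun x hx hxT => by
    refine ⟨hx, fun y hy => (hle y hy).trans (le_of_eq ?_)⟩
    rw [hl, LinearMap.sum_apply]
    exact Finset.sum_congr rfl fun j hj => (hxT j hj).symm
  have huC := hmem u hu.mem huT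
  have htight : ∀ x ∈ maxFace P l, ∀ j ∈ T, j.1 x = j.2 := by
    intro x hx
    have h1 : ∑ j ∈ T, j.2 ≤ l x := by
      refine le_trans (le_of_eq ?_) (hx.2 u hu.mem)
      rw [hl, LinearMap.sum_apply]
      exact Finset.sum_congr rfl fun j hj => (huT j hj).symm
    have h2 := le_antisymm (hle x hx.1) h1
    rw [hl, LinearMap.sum_apply] at h2
    exact (Finset.sum_eq_sum_iff_of_le fun j hj => hJ.le hx.1 (hT hj)).1 h2
  refine (isFace_maxFace hP l).isEdge hP ?_ hu hv huC (hmem v hv.mem hvT) huv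
  let φ : vectorSpan ℝ (maxFace P l) →ₗ[ℝ] ℝ := h ∘ₗ (vectorSpan ℝ (maxFace P l)).subtype
  have hinj : Function.Injective φ := by
    rw [injective_iff_map_eq_zero]
    intro w hw
    refine Subtype.ext (hzero w (vectorSpan_mono ℝ (fun x hx => hx.1) w.2) (fun j hj => ?_) hw)
    have hker : vectorSpan ℝ (maxFace P l) ≤ LinearMap.ker j.1 := by
      rw [vectorSpan_def, Submodule.span_le]
      rintro _ ⟨x, hx, y, hy, rfl⟩
      simp only [vsub_eq_sub, SetLike.mem_coe, LinearMap.mem_ker, map_sub, htight x hx j hj,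
        htight y hy j hj, sub_self]
    exact hker w.2
  exact (LinearMap.finrank_le_finrank_of_injective hinj).trans_eq (Module.finrank_self ℝ)

end MonotoneDiameter

namespace MonotoneDiameter

variable {E : Type*} [NormedAddCommGroup E] [NormedSpace ℝ E] [FiniteDimensional ℝ E]

/-! ### Layers of the directed graph -/

/-- If fewer than `d` vertices of a `d`-dimensional polytope, other than source and sink, are
forbidden, then the graph still contains a directed path from the source to the sink; in particular
some arc between vertices that are not forbidden leaves a given set `N` that separates source and
sink. The path consists of the vertices that maximize `g - r * f` for some `r`, where `g` is chosen
to be constant on the forbidden vertices and the source, not smaller at the sink, and larger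
somewhere on the polytope. -/
theorem exists_arc_leaving {P : Set E} (hP : IsPolytope P) {f : E →ₗ[ℝ] ℝ}
    (hf : IsAdmissible P f) {s t : E} (hs : IsSource P f s) (ht : IsSink P f t) {U : Finset E}
    (hU : U.card < affDim P) (hUv : ∀ u ∈ U, IsVertex P u) (hsU : s ∉ U) (htU : t ∉ U)
    {N : Set E} (hsN : s ∈ N) (htN : t ∉ N) :
    ∃ p q, IsVertex P p ∧ IsVertex P q ∧ Arc P f p q ∧ p ∈ N ∧ p ∉ U ∧ q ∉ N ∧ q ∉ U := by
  classical
  obtain ⟨g, hgU, hgt, p, hp, hgp⟩ : ∃ g : E →ₗ[ℝ] ℝ, (∀ u ∈ U, g u = g s) ∧ g s ≤ g t ∧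
      ∃ p ∈ P, g s < g p := by
    obtain ⟨x, hx, hxU⟩ : ∃ x ∈ P, x - s ∉ Submodule.span ℝ (U.image fun u => u - s : Set E) := by
      by_contra! hcon
      have hle : vectorSpan ℝ P ≤ Submodule.span ℝ (U.image fun u => u - s : Set E) := by
        rw [vectorSpan_eq_span_vsub_set_right ℝ hs.1.mem, Submodule.span_le]
        rintro _ ⟨x, hx, rfl⟩
        exact hcon x hx
      have h1 := Submodule.finrank_mono hle
      have h2 := (finrank_span_finset_le_card (R := ℝ) (U.image fun u => u - s)).trans
        Finset.card_image_le
      exact absurd hU (not_lt.2 (h1.trans h2))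
    obtain ⟨g, hgx, hg⟩ := Submodule.exists_le_ker_of_notMem hxU
    have hgU : ∀ u ∈ U, g u = g s := by
      intro u hu
      have : g (u - s) = 0 :=
        hg (Submodule.subset_span (Finset.mem_coe.2 (Finset.mem_image_of_mem _ hu)))
      rw [map_sub] at this
      linarith
    rw [map_sub] at hgx
    rcases lt_trichotomy (g s) (g t) with h | h | h
    · exact ⟨g, hgU, h.le, t, ht.1.mem, h⟩
    · rcases lt_or_gt_of_ne hgx with h' | h'
      · exact ⟨-g, fun u hu => by simp [hgU u hu], by simp [h], x, hx, by simp; linarith⟩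
      · exact ⟨g, hgU, h.le, x, hx, by linarith⟩
    · exact ⟨-g, fun u hu => by simp [hgU u hu], by simp [h.le], t, ht.1.mem, by simp [h]⟩
  let I : E → ℝ → Prop := fun v r => ∀ x ∈ P, g x - r * f x ≤ g v - r * f v
  have hIU : ∀ v r, I v r → v ∉ U := by
    intro v r hI hv
    have h1 := hI s hs.1.mem
    have h2 := hI t ht.1.mem
    have h3 := hI p hp
    rw [hgU v hv] at h1 h2 h3
    have h4 := hs.lt hP hf (hUv v hv).mem fun h => hsU (h ▸ hv)
    have h5 := ht.lt hP hf (hUv v hv).mem fun h => htU (h ▸ hv)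
    have hr1 : r ≤ 0 := by
      by_contra! h
      nlinarith
    have hr2 : 0 ≤ r := by
      by_contra! h
      nlinarith
    have hr : r = 0 := le_antisymm hr1 hr2
    rw [hr] at h3
    linarith
  have hIs : ∃ r, I s r := by
    obtain ⟨r, hr⟩ := (hP.finite_vertices.image fun w => (g w - g s) / (f w - f s)).bddAbove
    refine ⟨r, fun x hx => ?_⟩
    obtain ⟨w, hw, hmax⟩ := hP.exists_vertex_isMax (g - r • f)
    have h1 := hmax x hx
    simp only [LinearMap.sub_apply, LinearMap.smul_apply, smul_eq_mul] at h1
    refine h1.trans ?_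
    by_cases hws : w = s
    · rw [hws]
    · have h2 := hr (Set.mem_image_of_mem _ hw)
      have h3 := hs.lt hP hf hw.mem hws
      rw [div_le_iff₀ (sub_pos.2 h3)] at h2
      linarith
  -- the path leaves `v` along the arc with the largest slope of `g` over `f`
  have hstep : ∀ v, IsVertex P v → v ≠ t → ∀ r, I v r →
      ∃ w, IsVertex P w ∧ Arc P f v w ∧ ∃ r', I w r' := by
    intro v hv hvt r hr
    have hfin : {w | IsVertex P w ∧ Arc P f v w}.Finite :=
      hP.finite_vertices.subset fun w hw => hw.1
    obtain ⟨w₀, hw₀, hw₀e, hw₀f⟩ := hv.exists_isEdge hP f ⟨t, ht.1.mem, ht.lt hP hf hv.mem hvt⟩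
    obtain ⟨w, ⟨hw, hwa⟩, hmax⟩ := Set.exists_max_image _
      (fun w => (g w - g v) / (f w - f v)) hfin ⟨w₀, hw₀, hw₀e, hw₀f⟩
    refine ⟨w, hw, hwa, (g w - g v) / (f w - f v), ?_⟩
    have hd : 0 < f w - f v := sub_pos.2 hwa.2
    set r' := (g w - g v) / (f w - f v) with hr'
    have hwr : g w - g v = r' * (f w - f v) := by rw [hr', div_mul_cancel₀ _ hd.ne']
    have hrr : r' ≤ r := by
      rw [hr', div_le_iff₀ hd]
      linarith [hr w hw.mem]
    intro x hx
    have hvx : g x - r' * f x ≤ g v - r' * f v := by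
      by_contra! hlt
      obtain ⟨z, hz, hze, hzlt⟩ := hv.exists_isEdge hP (g - r' • f) ⟨x, hx, by simpa using hlt⟩
      simp only [LinearMap.sub_apply, LinearMap.smul_apply, smul_eq_mul] at hzlt
      rcases lt_or_gt_of_ne (hf.ne hze) with h | h
      · have := hmax z ⟨hz, hze, h⟩
        rw [div_le_iff₀ (sub_pos.2 h)] at this
        linarith
      · have := hr z hz.mem
        nlinarith
    linarith
  have hfin : {v | IsVertex P v ∧ v ∈ N ∧ ∃ r, I v r}.Finite :=
    hP.finite_vertices.subset fun v hv => hv.1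
  obtain ⟨v, ⟨hv, hvN, r, hr⟩, hmax⟩ := Set.exists_max_image _ f hfin ⟨s, hs.1, hsN, hIs⟩
  obtain ⟨w, hw, hwa, r', hr'⟩ := hstep v hv (fun h => htN (h ▸ hvN)) r hr
  refine ⟨v, w, hv, hw, hwa, hvN, hIU v r hr, fun hwN => ?_, hIU w r' hr'⟩
  exact (hmax w ⟨hw, hwN, r', hr'⟩).not_gt hwa.2

open Classical in
/-- If the sink is at distance more than `k` from the source, then each of the `k` layers of
vertices between them, in the order of the distance to the sink, has at least `d` elements. -/
theorem le_card_vertices {P : Set E} (hP : IsPolytope P) {f : E →ₗ[ℝ] ℝ}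
    (hf : IsAdmissible P f) {s t : E} (hs : IsSource P f s) (ht : IsSink P f t) (k : ℕ)
    (hk : ∀ i ≤ k, ¬ HasDirectedPath P f i s t) :
    2 + k * affDim P ≤ hP.finite_vertices.toFinset.card := by
  let N : ℕ → Finset E := fun k =>
    hP.finite_vertices.toFinset.filter fun v => ∃ i ≤ k, HasDirectedPath P f i v t
  have hmemN : ∀ k v, v ∈ N k ↔ IsVertex P v ∧ ∃ i ≤ k, HasDirectedPath P f i v t := by
    intro k v
    simp [N]
  have htN : ∀ k, t ∈ N k := fun k => (hmemN k t).2 ⟨ht.1, 0, Nat.zero_le _, .refl P f t⟩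
  have hcard : ∀ j ≤ k, 1 + j * affDim P ≤ (N j).card := by
    intro j
    induction j with
    | zero =>
      intro _
      rw [zero_mul, add_zero, Nat.succ_le_iff, Finset.card_pos]
      exact ⟨t, htN 0⟩
    | succ j ih =>
      intro hj
      have hsub : N j ⊆ N (j + 1) := by
        intro v hv
        obtain ⟨hv, i, hi, hp⟩ := (hmemN j v).1 hv
        exact (hmemN _ v).2 ⟨hv, i, by omega, hp⟩
      have hlayer : affDim P ≤ (N (j + 1) \ N j).card := by
        by_contra! hlt
        have hsU : s ∉ N (j + 1) := fun h => by
          obtain ⟨-, i, hi, hp⟩ := (hmemN _ s).1 h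
          exact hk i (hi.trans hj) hp
        obtain ⟨p, q, hp, hq, ha, hpN, hpU, hqN, -⟩ := exists_arc_leaving hP hf hs ht hlt
          (fun u hu => ((hmemN _ u).1 (Finset.mem_sdiff.1 hu).1).1)
          (fun h => hsU (Finset.mem_sdiff.1 h).1)
          (fun h => (Finset.mem_sdiff.1 h).2 (htN j)) (N := {v | v ∉ N j})
          (fun h => hsU (hsub h)) (fun h => h (htN j))
        obtain ⟨-, i, hi, hpath⟩ := (hmemN j q).1 (not_not.1 hqN)
        exact hpU (Finset.mem_sdiff.2
          ⟨(hmemN _ p).2 ⟨hp, i + 1, by omega, hpath.cons ha⟩, hpN⟩)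
      have := Finset.card_sdiff_add_card_eq_card hsub
      have := ih (by omega)
      rw [add_mul, one_mul]
      omega
  have hsN : s ∉ N k := fun h => by
    obtain ⟨-, i, hi, hp⟩ := (hmemN _ s).1 h
    exact hk i hi hp
  have h1 := Finset.card_le_card (s := insert s (N k)) (t := hP.finite_vertices.toFinset) (by
    intro v hv
    rcases Finset.mem_insert.1 hv with rfl | hv
    · simpa using hs.1
    · exact (Finset.mem_filter.1 hv).1)
  rw [Finset.card_insert_of_notMem hsN] at h1
  have := hcard k le_rfl
  omega

/-! ### The number of vertices of a three-dimensional polytope -/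

/-- Three vectors `y i` of a plane and three functionals `a i` with `a i (y i) = 0` cannot satisfy
`a i (y k) < 0` for all `i ≠ k`: the coefficients of a linear relation between the `y i` would
have pairwise different signs. -/
theorem exists_nonneg_of_finrank_lt_three {V : Type*} [AddCommGroup V] [Module ℝ V]
    (D : Submodule ℝ V) [FiniteDimensional ℝ D] (hD : Module.finrank ℝ D < 3) (y : Fin 3 → V)
    (hy : ∀ i, y i ∈ D) (a : Fin 3 → V →ₗ[ℝ] ℝ) (ha : ∀ i, a i (y i) = 0) :
    ∃ i k, i ≠ k ∧ 0 ≤ a i (y k) := by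
  by_contra! hcon
  have hdep : ¬ LinearIndependent ℝ fun i => (⟨y i, hy i⟩ : D) := by
    intro h
    have := h.fintype_card_le_finrank
    rw [Fintype.card_fin] at this
    omega
  obtain ⟨c, hc, i, hi⟩ := Fintype.not_linearIndependent_iff.1 hdep
  have hc' : c 0 • y 0 + c 1 • y 1 + c 2 • y 2 = 0 := by
    have := congrArg Subtype.val hc
    simpa [Fin.sum_univ_three] using this
  have hrel : ∀ l : V →ₗ[ℝ] ℝ, c 0 * l (y 0) + c 1 * l (y 1) + c 2 * l (y 2) = 0 := by
    intro l
    have := congrArg l hc'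
    simpa using this
  have e0 := hrel (a 0)
  have e1 := hrel (a 1)
  have e2 := hrel (a 2)
  rw [ha] at e0 e1 e2
  have h01 := hcon 0 1 (by decide)
  have h02 := hcon 0 2 (by decide)
  have h10 := hcon 1 0 (by decide)
  have h12 := hcon 1 2 (by decide)
  have h20 := hcon 2 0 (by decide)
  have h21 := hcon 2 1 (by decide)
  have opp : ∀ {x y α β : ℝ}, α < 0 → β < 0 → x * α + y * β = 0 →
      (0 < x → y < 0) ∧ (x < 0 → 0 < y) ∧ (x = 0 → y = 0) := by
    intro x y α β hα hβ h
    refine ⟨fun hx => ?_, fun hx => ?_, fun hx => ?_⟩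
    · by_contra! hy
      nlinarith
    · by_contra! hy
      nlinarith
    · rw [hx, zero_mul, zero_add] at h
      exact (mul_eq_zero.1 h).resolve_right hβ.ne
  obtain ⟨p0, n0, z0⟩ := opp (x := c 1) (y := c 2) h01 h02 (by linarith)
  obtain ⟨p1, n1, z1⟩ := opp (x := c 0) (y := c 2) h10 h12 (by linarith)
  obtain ⟨p2, n2, z2⟩ := opp (x := c 0) (y := c 1) h20 h21 (by linarith)
  rcases lt_trichotomy (c 0) 0 with h | h | h
  · linarith [p0 (n2 h), n1 h]
  · fin_cases i
    · exact hi h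
    · exact hi (z2 h)
    · exact hi (z1 h)
  · linarith [n0 (p2 h), p1 h]

/-- Each vertex of a three-dimensional polytope, other than source and sink, is the source or
the sink of one of the facets through it: at most two facets through `v` cross the level of `v`,
as each of them contributes an edge to the polygon in which this level meets the polytope. -/
theorem Presents.exists_isMin_or_isMax {P : Set E} {J : Finset ((E →ₗ[ℝ] ℝ) × ℝ)}
    (hJ : Presents P J) (hP : IsPolytope P) (hdim : affDim P = 3) {f : E →ₗ[ℝ] ℝ}
    (hf : IsAdmissible P f) {s v : E} (hs : IsSource P f s) (hv : IsVertex P v) (hvs : v ≠ s) :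
    ∃ j ∈ J, v ∈ tightFace P j ∧
      ((∀ x ∈ tightFace P j, f v ≤ f x) ∨ ∀ x ∈ tightFace P j, f x ≤ f v) := by
  classical
  by_contra! hcon
  set T := J.filter fun j => j.1 v = j.2
  obtain ⟨e⟩ : Nonempty (Fin 3 ↪ T) := by
    refine Function.Embedding.nonempty_of_card_le ?_
    rw [Fintype.card_fin, Fintype.card_coe, ← hdim]
    exact hJ.finrank_le_card hP hv
  have heJ : ∀ i, (e i).1 ∈ J := fun i => (Finset.mem_filter.1 (e i).2).1
  have hev : ∀ i, v ∈ tightFace P (e i).1 := fun i => ⟨hv.mem, (Finset.mem_filter.1 (e i).2).2⟩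
  have hex : ∀ i, ∃ z ∈ tightFace P (e i).1, z ≠ v ∧ f z = f v := by
    intro i
    obtain ⟨⟨p, hp, hpv⟩, q, hq, hqv⟩ := hcon _ (heJ i) (hev i)
    have hF := hJ.isFace_tightFace hP (heJ i)
    exact ((isVertex_face_iff hP hF).2 ⟨hv, hev i⟩).exists_ne_of_between (hF.isPolytope hP)
      hp hq hpv hqv
  choose z hz hzv hfz using hex
  have hlt : Module.finrank ℝ (vectorSpan ℝ P ⊓ LinearMap.ker f : Submodule ℝ E) < 3 := by
    rw [← hdim]
    refine Submodule.finrank_lt_finrank_of_lt (lt_of_le_of_ne inf_le_left fun h => ?_)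
    have h1 : v - s ∈ LinearMap.ker f :=
      inf_eq_left.1 h (vsub_mem_vectorSpan ℝ hv.mem hs.1.mem)
    rw [LinearMap.mem_ker, map_sub] at h1
    linarith [hs.lt hP hf hv.mem hvs]
  obtain ⟨i, k, hik, hpos⟩ := exists_nonneg_of_finrank_lt_three _ hlt (fun i => z i - v)
    (fun i => ⟨vsub_mem_vectorSpan ℝ (hz i).1 hv.mem, by
      rw [SetLike.mem_coe, LinearMap.mem_ker, map_sub, hfz, sub_self]⟩)
    (fun i => (e i).1.1) (fun i => by rw [map_sub, (hz i).2, (hev i).2, sub_self])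
  -- the facets `i` and `k` meet in a face of dimension at most one on which `f` is constant
  have hzi : z k ∈ tightFace P (e i).1 := by
    refine ⟨(hz k).1, le_antisymm (hJ.le (hz k).1 (heJ i)) ?_⟩
    simp only [map_sub, (hev i).2] at hpos
    linarith
  set C : Set E := tightFace P (e i).1 ∩ tightFace P (e k).1 with hC
  have hCf : IsFace P C := ⟨⟨v, hev i, hev k⟩,
    (hJ.isFace_tightFace hP (heJ i)).2.inter (hJ.isFace_tightFace hP (heJ k)).2⟩
  have hCle : vectorSpan ℝ C ≤ vectorSpan ℝ (tightFace P (e k).1) :=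
    vectorSpan_mono ℝ Set.inter_subset_right
  have hCdim : Module.finrank ℝ (vectorSpan ℝ C) ≤ 1 := by
    by_contra! hgt
    have hk := hJ.affDim_tightFace (heJ k)
    rw [hdim, affDim] at hk
    have heq := Submodule.eq_of_le_of_finrank_le hCle (by omega)
    obtain ⟨y, hy, hyk, hyi⟩ := hJ.tight _ (heJ k)
    have h1 : y - v ∈ vectorSpan ℝ (tightFace P (e k).1) :=
      vsub_mem_vectorSpan ℝ ⟨hy, hyk⟩ (hev k)
    rw [← heq] at h1
    have h2 := vectorSpan_mono ℝ Set.inter_subset_left h1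
    rw [hJ.vectorSpan_tightFace (heJ i)] at h2
    have h3 := h2.2
    rw [SetLike.mem_coe, LinearMap.mem_ker, map_sub, (hev i).2] at h3
    have h4 := hyi _ (heJ i) fun h => hik (e.injective (Subtype.ext h))
    linarith
  have hzC : z k - v ∈ vectorSpan ℝ C := vsub_mem_vectorSpan ℝ ⟨hzi, hz k⟩ ⟨hev i, hev k⟩
  have hker : vectorSpan ℝ C ≤ LinearMap.ker f := by
    intro w hw
    have hne : (⟨z k - v, hzC⟩ : vectorSpan ℝ C) ≠ 0 :=
      fun h => sub_ne_zero.2 (hzv k) (congrArg Subtype.val h)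
    obtain ⟨y, hy⟩ := finrank_le_one_iff.1 hCdim
    obtain ⟨c, hc⟩ := hy ⟨_, hzC⟩
    obtain ⟨c', hc'⟩ := hy ⟨w, hw⟩
    have hc0 : c ≠ 0 := by
      rintro rfl
      rw [zero_smul] at hc
      exact hne hc.symm
    have h1 : f (z k - v) = c * f y := by
      rw [← smul_eq_mul, ← map_smul]
      exact congrArg f (congrArg Subtype.val hc).symm
    have h2 : f w = c' * f y := by
      rw [← smul_eq_mul, ← map_smul]
      exact congrArg f (congrArg Subtype.val hc').symm
    rw [map_sub, hfz, sub_self] at h1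
    rw [LinearMap.mem_ker, h2, (mul_eq_zero.1 h1.symm).resolve_left hc0, mul_zero]
  refine hzv k (hf.subsingleton_of_const hP hCf (fun x hx y hy => ?_) ⟨hzi, hz k⟩ ⟨hev i, hev k⟩)
  have := hker (vsub_mem_vectorSpan ℝ hx hy)
  rw [LinearMap.mem_ker, vsub_eq_sub, map_sub] at this
  linarith

open Classical in
/-- A facet has only one source, which is not the source of the polytope unless the latter lies on
it. -/
theorem Presents.card_isMin_le {P : Set E} {J : Finset ((E →ₗ[ℝ] ℝ) × ℝ)} (hJ : Presents P J)
    (hP : IsPolytope P) {f : E →ₗ[ℝ] ℝ} (hf : IsAdmissible P f) {s : E} (hs : IsSource P f s) :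
    (hP.finite_vertices.toFinset.filter fun v => v ≠ s ∧ ∃ j ∈ J, v ∈ tightFace P j ∧
      ∀ x ∈ tightFace P j, f v ≤ f x).card + affDim P ≤ J.card := by
  have h1 : (hP.finite_vertices.toFinset.filter fun v => v ≠ s ∧ ∃ j ∈ J, v ∈ tightFace P j ∧
      ∀ x ∈ tightFace P j, f v ≤ f x).card ≤ (J.filter fun j => ¬ j.1 s = j.2).card := by
    have hex : ∀ v : E, ∃ j : (E →ₗ[ℝ] ℝ) × ℝ, (v ≠ s ∧ ∃ j ∈ J, v ∈ tightFace P j ∧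
        ∀ x ∈ tightFace P j, f v ≤ f x) →
        j ∈ J ∧ v ∈ tightFace P j ∧ ∀ x ∈ tightFace P j, f v ≤ f x := by
      intro v
      by_cases h : v ≠ s ∧ ∃ j ∈ J, v ∈ tightFace P j ∧ ∀ x ∈ tightFace P j, f v ≤ f x
      · obtain ⟨j, hj⟩ := h.2
        exact ⟨j, fun _ => hj⟩
      · exact ⟨0, fun h' => absurd h' h⟩
    choose φ hφ using hex
    refine Finset.card_le_card_of_injOn φ (fun v hv => ?_) fun v hv w hw hvw => ?_
    · have hv' := (Finset.mem_filter.1 hv).2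
      obtain ⟨hj, hvj, hmin⟩ := hφ v hv'
      refine Finset.mem_filter.2 ⟨hj, fun hsj => ?_⟩
      exact (hs.lt hP hf hvj.1 hv'.1).not_ge (hmin s ⟨hs.1.mem, hsj⟩)
    · obtain ⟨hj, hvj, hvmin⟩ := hφ v (Finset.mem_filter.1 hv).2
      obtain ⟨-, hwj, hwmin⟩ := hφ w (Finset.mem_filter.1 hw).2
      rw [← hvw] at hwj hwmin
      have hF := hJ.isFace_tightFace hP hj
      exact (hf.face hP hF).eq_of_isMin (hF.isPolytope hP) hvj hwj hvmin hwmin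
  have h2 := hJ.finrank_le_card hP hs.1
  have h3 := Finset.card_filter_add_card_filter_not (s := J) fun j => j.1 s = j.2
  omega

/-- A three-dimensional polytope with `n` facets has at most `2 n - 4` vertices. -/
theorem Presents.card_vertices_le {P : Set E} {J : Finset ((E →ₗ[ℝ] ℝ) × ℝ)} (hJ : Presents P J)
    (hP : IsPolytope P) (hdim : affDim P = 3) {f : E →ₗ[ℝ] ℝ} (hf : IsAdmissible P f) {s t : E}
    (hs : IsSource P f s) (ht : IsSink P f t) :
    hP.finite_vertices.toFinset.card + 4 ≤ 2 * J.card := by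
  classical
  have ht' : IsSource P (-f) t :=
    ⟨ht.1, fun u hu => ht.2 u ⟨hu.1.symm, by simpa using hu.2⟩⟩
  have h1 := hJ.card_isMin_le hP hf hs
  have h2 := hJ.card_isMin_le hP hf.neg ht'
  have hsub : hP.finite_vertices.toFinset ⊆ {s, t} ∪
      ((hP.finite_vertices.toFinset.filter fun v => v ≠ s ∧ ∃ j ∈ J, v ∈ tightFace P j ∧
        ∀ x ∈ tightFace P j, f v ≤ f x) ∪
      (hP.finite_vertices.toFinset.filter fun v => v ≠ t ∧ ∃ j ∈ J, v ∈ tightFace P j ∧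
        ∀ x ∈ tightFace P j, (-f) v ≤ (-f) x)) := by
    intro v hv
    have hvP : IsVertex P v := by simpa using hv
    by_cases hvs : v = s
    · simp [hvs]
    by_cases hvt : v = t
    · simp [hvt]
    obtain ⟨j, hj, hvj, h⟩ := hJ.exists_isMin_or_isMax hP hdim hf hs hvP hvs
    refine Finset.mem_union_right _ (Finset.mem_union.2 ?_)
    rcases h with h | h
    · exact Or.inl (Finset.mem_filter.2 ⟨hv, hvs, j, hj, hvj, h⟩)
    · exact Or.inr (Finset.mem_filter.2 ⟨hv, hvt, j, hj, hvj, fun x hx => neg_le_neg (h x hx)⟩)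
  have h3 := Finset.card_le_card hsub
  have h4 := h3.trans (Finset.card_union_le _ _)
  have h5 := h4.trans (Nat.add_le_add_left (Finset.card_union_le _ _) _)
  have h6 : ({s, t} : Finset E).card ≤ 2 := Finset.card_le_two
  rw [hdim] at h1 h2
  omega

/-! ### Short directed paths in dimensions three, four and five -/

/-- Four layers of three vertices each, the source and the sink exceed the bound of twelve
vertices. -/
theorem exists_path_dim_three {P : Set E} (hP : IsPolytope P) {J : Finset ((E →ₗ[ℝ] ℝ) × ℝ)}
    (hJ : Presents P J) (hdim : affDim P = 3) (hcard : J.card ≤ 8) {f : E →ₗ[ℝ] ℝ}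
    (hf : IsAdmissible P f) {s t : E} (hs : IsSource P f s) (ht : IsSink P f t) :
    ∃ k ≤ 4, HasDirectedPath P f k s t := by
  by_contra! hcon
  have h1 := le_card_vertices hP hf hs ht 4 hcon
  have h2 := hJ.card_vertices_le hP hdim hf hs ht
  omega

/-- Let `x` be the lowest of the vertices on the facets through the sink `t`. It is the source
of such a facet, and unless it is the source of `P` it has a lower neighbour, through which none of
the facets at `t` passes. -/
theorem Presents.exists_first {P : Set E} {J : Finset ((E →ₗ[ℝ] ℝ) × ℝ)} (hJ : Presents P J)
    (hP : IsPolytope P) (hdim : 0 < affDim P) {f : E →ₗ[ℝ] ℝ} (hf : IsAdmissible P f) {s t : E}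
    (hs : IsSource P f s) (ht : IsSink P f t) :
    ∃ j ∈ J, t ∈ tightFace P j ∧ ∃ x, IsSource (tightFace P j) f x ∧ (x = s ∨
      ∃ v, IsVertex P v ∧ Arc P f v x ∧ ∀ k ∈ J, t ∈ tightFace P k → v ∉ tightFace P k) := by
  classical
  have hfin : {x | IsVertex P x ∧ ∃ j ∈ J, t ∈ tightFace P j ∧ x ∈ tightFace P j}.Finite :=
    hP.finite_vertices.subset fun x hx => hx.1
  obtain ⟨j₀, hj₀⟩ := Finset.card_pos.1 (hdim.trans_le (hJ.finrank_le_card hP ht.1))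
  rw [Finset.mem_filter] at hj₀
  have htj₀ : t ∈ tightFace P j₀ := ⟨ht.1.mem, hj₀.2⟩
  obtain ⟨x, ⟨hx, j, hj, htj, hxj⟩, hmin⟩ := Set.exists_min_image _ f hfin
    ⟨t, ht.1, j₀, hj₀.1, htj₀, htj₀⟩
  have hF := hJ.isFace_tightFace hP hj
  refine ⟨j, hj, htj, x, isSource_of_le ((isVertex_face_iff hP hF).2 ⟨hx, hxj⟩) fun y hy => ?_, ?_⟩
  · obtain ⟨w, hw, hwmax⟩ := (hF.isPolytope hP).exists_vertex_isMax (-f)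
    have h1 := (isVertex_face_iff hP hF).1 hw
    have h2 := hmin w ⟨h1.1, j, hj, htj, h1.2⟩
    have h3 := hwmax y hy
    simp only [LinearMap.neg_apply] at h3
    linarith
  · by_cases hxs : x = s
    · exact Or.inl hxs
    · obtain ⟨v, hv, he, hlt⟩ := hx.exists_isEdge hP (-f)
        ⟨s, hs.1.mem, by simpa using hs.lt hP hf hx.mem hxs⟩
      have hlt' : f v < f x := by simpa using hlt
      exact Or.inr ⟨v, hv, ⟨he.symm, hlt'⟩, fun k hk htk hvk =>
        (hmin v ⟨hv, k, hk, htk, hvk⟩).not_gt hlt'⟩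

/-- If source and sink share no facet, the path is `s → v → x → ⋯ → t` with `x` and `v` as in
`Presents.exists_first`, and it ends within a facet through `t`. -/
theorem exists_path_dim_four {P : Set E} (hP : IsPolytope P) {J : Finset ((E →ₗ[ℝ] ℝ) × ℝ)}
    (hJ : Presents P J) (hdim : affDim P = 4) (hcard : J.card ≤ 9) {f : E →ₗ[ℝ] ℝ}
    (hf : IsAdmissible P f) {s t : E} (hs : IsSource P f s) (ht : IsSink P f t) :
    ∃ k ≤ 6, HasDirectedPath P f k s t := by
  classical
  -- a facet through the sink contains a path of length at most four from its source to the sink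
  have hfacet : ∀ j ∈ J, t ∈ tightFace P j → ∀ x, IsSource (tightFace P j) f x →
      ∃ k ≤ 4, HasDirectedPath P f k x t := by
    intro j hj htj x hx
    obtain ⟨K, hK, hKP⟩ := hJ.exists_presents_tightFace hP hj
    have hF := hJ.isFace_tightFace hP hj
    have h1 := hJ.affDim_tightFace hj
    have h2 := Finset.card_le_card hK
    rw [Finset.card_erase_of_mem hj] at h2
    obtain ⟨k, hk, hp⟩ := exists_path_dim_three (hF.isPolytope hP) hKP (by omega) (by omega)
      (hf.face hP hF) hx (ht.face hP hF htj)
    exact ⟨k, hk, hp.of_face hP hF⟩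
  by_cases hshare : ∃ j ∈ J, s ∈ tightFace P j ∧ t ∈ tightFace P j
  · obtain ⟨j, hj, hsj, htj⟩ := hshare
    obtain ⟨k, hk, hp⟩ := hfacet j hj htj s (hs.face hP (hJ.isFace_tightFace hP hj) hsj)
    exact ⟨k, by omega, hp⟩
  push Not at hshare
  obtain ⟨j, hj, htj, x, hx, hxs | ⟨v, hv, hvx, hvt⟩⟩ :=
    hJ.exists_first hP (by omega) hf hs ht
  · exact absurd htj (hshare j hj (hxs ▸ hx.1.mem))
  obtain ⟨k, hk, hp⟩ := hfacet j hj htj x hx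
  by_cases hvs : v = s
  · exact ⟨k + 1, by omega, hp.cons (hvs ▸ hvx)⟩
  -- at most one facet contains neither `s` nor `t`
  have hrest : (J.filter fun j => ¬ j.1 s = j.2 ∧ ¬ j.1 t = j.2).card ≤ 1 := by
    have h1 := hJ.finrank_le_card hP hs.1
    have h2 := hJ.finrank_le_card hP ht.1
    have hsub : (J.filter fun j => ¬ j.1 s = j.2 ∧ ¬ j.1 t = j.2) ∪
        ((J.filter fun j => j.1 s = j.2) ∪ J.filter fun j => j.1 t = j.2) ⊆ J := by
      simp [Finset.union_subset_iff]
    have h3 := Finset.card_le_card hsub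
    rw [Finset.card_union_of_disjoint, Finset.card_union_of_disjoint] at h3
    · omega
    · rw [Finset.disjoint_left]
      intro i hi hi'
      rw [Finset.mem_filter] at hi hi'
      exact hshare i hi.1 ⟨hs.1.mem, hi.2⟩ ⟨ht.1.mem, hi'.2⟩
    · rw [Finset.disjoint_left]
      intro i hi hi'
      rw [Finset.mem_filter] at hi
      rcases Finset.mem_union.1 hi' with h | h
      · exact hi.2.1 (Finset.mem_filter.1 h).2
      · exact hi.2.2 (Finset.mem_filter.1 h).2
  rw [Finset.card_le_one] at hrest
  have hnt : ∀ i ∈ J, i.1 v = i.2 → ¬ i.1 t = i.2 := fun i hi hiv hit =>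
    hvt i hi ⟨ht.1.mem, hit⟩ ⟨hv.mem, hiv⟩
  obtain ⟨h, hh⟩ : ∃ h : E →ₗ[ℝ] ℝ, ∀ i ∈ J, i.1 v = i.2 → ¬ i.1 s = i.2 → i.1 = h := by
    by_cases hex : ∃ i ∈ J, i.1 v = i.2 ∧ ¬ i.1 s = i.2
    · obtain ⟨i, hi, hiv, his⟩ := hex
      refine ⟨i.1, fun i' hi' hiv' his' => ?_⟩
      rw [hrest i' (Finset.mem_filter.2 ⟨hi', his', hnt i' hi' hiv'⟩) i
        (Finset.mem_filter.2 ⟨hi, his, hnt i hi hiv⟩)]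
    · exact ⟨0, fun i hi hiv his => absurd ⟨i, hi, hiv, his⟩ hex⟩
  have hedge : IsEdge P s v := isEdge_of_common_tight hP hJ
    (T := J.filter fun i => i.1 s = i.2 ∧ i.1 v = i.2) (Finset.filter_subset _ _) h hs.1 hv
    (Ne.symm hvs) (fun i hi => (Finset.mem_filter.1 hi).2.1)
    (fun i hi => (Finset.mem_filter.1 hi).2.2) fun w hw hT hhw => by
      refine hJ.eq_zero_of_tight hP hv hw fun i hi hiv => ?_
      by_cases his : i.1 s = i.2
      · exact hT i (Finset.mem_filter.2 ⟨hi, his, hiv⟩)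
      · rw [hh i hi hiv his, hhw]
  exact ⟨k + 1 + 1, by omega, (hp.cons hvx).cons ⟨hedge, hs.lt hP hf hv.mem hvs⟩⟩

/-- If source and sink share no facet, the path is `s → v' → x → ⋯ → t`, or this without `v'`. It
runs within a facet `F` after its first arc, and ends within a facet of `F` through `t`. -/
theorem exists_path_dim_five {P : Set E} (hP : IsPolytope P) {J : Finset ((E →ₗ[ℝ] ℝ) × ℝ)}
    (hJ : Presents P J) (hdim : affDim P = 5) (hcard : J.card ≤ 10) {f : E →ₗ[ℝ] ℝ}
    (hf : IsAdmissible P f) {s t : E} (hs : IsSource P f s) (ht : IsSink P f t) :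
    ∃ k ≤ 6, HasDirectedPath P f k s t := by
  classical
  by_cases hshare : ∃ j ∈ J, s ∈ tightFace P j ∧ t ∈ tightFace P j
  · obtain ⟨j, hj, hsj, htj⟩ := hshare
    obtain ⟨K, hK, hKP⟩ := hJ.exists_presents_tightFace hP hj
    have hF := hJ.isFace_tightFace hP hj
    have h1 := hJ.affDim_tightFace hj
    have h2 := Finset.card_le_card hK
    rw [Finset.card_erase_of_mem hj] at h2
    obtain ⟨k, hk, hp⟩ := exists_path_dim_four (hF.isPolytope hP) hKP (by omega) (by omega)
      (hf.face hP hF) (hs.face hP hF hsj) (ht.face hP hF htj)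
    exact ⟨k, hk, hp.of_face hP hF⟩
  push Not at hshare
  -- every facet contains exactly one of `s` and `t`
  have hall : ∀ i ∈ J, ¬ i.1 t = i.2 → i.1 s = i.2 := by
    have h1 := hJ.finrank_le_card hP hs.1
    have h2 := hJ.finrank_le_card hP ht.1
    have hdisj : Disjoint (J.filter fun j => j.1 s = j.2) (J.filter fun j => j.1 t = j.2) := by
      rw [Finset.disjoint_left]
      intro i hi hi'
      rw [Finset.mem_filter] at hi hi'
      exact hshare i hi.1 ⟨hs.1.mem, hi.2⟩ ⟨ht.1.mem, hi'.2⟩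
    have heq : (J.filter fun j => j.1 s = j.2) ∪ (J.filter fun j => j.1 t = j.2) = J := by
      refine Finset.eq_of_subset_of_card_le (by simp [Finset.union_subset_iff]) ?_
      rw [Finset.card_union_of_disjoint hdisj]
      omega
    intro i hi hit
    rw [← heq] at hi
    rcases Finset.mem_union.1 hi with h | h
    · exact (Finset.mem_filter.1 h).2
    · exact absurd (Finset.mem_filter.1 h).2 hit
  -- a facet `F` through the sink whose source is a neighbour of `s`
  obtain ⟨j, hj, htj, x₁, hx₁, hxs | ⟨v, hv, hvx, hvt⟩⟩ :=
    hJ.exists_first hP (by omega) hf hs ht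
  · exact absurd htj (hshare j hj (hxs ▸ hx₁.1.mem))
  have hvs : v = s := by
    have : s - v = 0 := hJ.eq_zero_of_tight hP hv (vsub_mem_vectorSpan ℝ hs.1.mem hv.mem)
      fun i hi hiv => by
        rw [map_sub, hiv, hall i hi fun hit => hvt i hi ⟨ht.1.mem, hit⟩ ⟨hv.mem, hiv⟩, sub_self]
    exact (sub_eq_zero.1 this).symm
  rw [hvs] at hvx
  obtain ⟨K, hK, hKP⟩ := hJ.exists_presents_tightFace hP hj
  have hF := hJ.isFace_tightFace hP hj
  have hFP := hF.isPolytope hP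
  have hdimF := hJ.affDim_tightFace hj
  have hcardK := Finset.card_le_card hK
  rw [Finset.card_erase_of_mem hj] at hcardK
  have hfF := hf.face hP hF
  have htF := ht.face hP hF htj
  -- a facet `G` of `F` through the sink whose source is at distance at most two from `s`
  obtain ⟨i, hi, hti, x, hx, hxv⟩ := hKP.exists_first hFP (by omega) hfF hx₁ htF
  obtain ⟨K', hK', hKP'⟩ := hKP.exists_presents_tightFace hFP hi
  have hG := hKP.isFace_tightFace hFP hi
  have hdimG := hKP.affDim_tightFace hi
  have hcardK' := Finset.card_le_card hK'
  rw [Finset.card_erase_of_mem hi] at hcardK'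
  obtain ⟨k, hk, hp⟩ := exists_path_dim_three (hG.isPolytope hFP) hKP' (by omega) (by omega)
    (hfF.face hFP hG) hx (htF.face hFP hG hti)
  have hp' := (hp.of_face hFP hG).of_face hP hF
  rcases hxv with rfl | ⟨v', hv', hvx', hvt'⟩
  · exact ⟨k + 1, by omega, hp'.cons hvx⟩
  have hv'P := ((isVertex_face_iff hP hF).1 hv').1
  have hv's : v' ≠ s := fun h => hshare j hj (h ▸ hv'.mem) htj
  have hKJ : K ⊆ J := hK.trans (Finset.erase_subset _ _)
  have hedge : IsEdge P s v' := isEdge_of_common_tight hP hJ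
    (T := K.filter fun i => i.1 v' = i.2) ((Finset.filter_subset _ _).trans hKJ) j.1 hs.1 hv'P
    hv's.symm (fun i hi => by
      rw [Finset.mem_filter] at hi
      exact hall i (hKJ hi.1) fun hit => hvt' i hi.1 ⟨htj, hit⟩ ⟨hv'.mem, hi.2⟩)
    (fun i hi => (Finset.mem_filter.1 hi).2) fun w hw hT hjw => by
      refine hKP.eq_zero_of_tight hFP hv' ?_ fun i hi hiv => hT i (Finset.mem_filter.2 ⟨hi, hiv⟩)
      rw [hJ.vectorSpan_tightFace hj]
      exact ⟨hw, hjw⟩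
  exact ⟨k + 1 + 1, by omega, (hp'.cons ⟨hvx'.1.of_face hP hF, hvx'.2⟩).cons
    ⟨hedge, hs.lt hP hf hv'P.mem hv's⟩⟩

end MonotoneDiameter

theorem mainTheorem6 : MonotoneDiameter.deltaSM 5 10 ≤ 6 := by
  refine sSup_le ?_
  rintro l ⟨m, P, f, s, t, hP, hdim, hfacets, hf, hs, ht, rfl⟩
  obtain ⟨J, hJ, hcard⟩ := hP.exists_presents
  rw [hfacets] at hcard
  obtain ⟨k, hk, hp⟩ := MonotoneDiameter.exists_path_dim_five hP hJ hdim (by exact_mod_cast hcard)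
    hf hs ht
  have hle : MonotoneDiameter.directedDist P f s t ≤ k := sInf_le ⟨k, rfl, hp⟩
  exact hle.trans (by exact_mod_cast hk)
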